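/- Fix $k\ge 2$, integers $L,N\ge 1$, reals $C,\delta>0$ with $C<(1-2\delta)/\log(2k-1)$, and $\beta>0$. Let $r$ be a uniformly random cyclically reduced word of length $n$ in the free group $F_k$, regarded as a cyclic word. Let $\varepsilon(n)\to 0$. A bead decomposition of $r$ is a decomposition of $r$ into segments $r_0,r_1^+,\dots,r_{M-1}^+,r_M,r_{M-1}^-,\dots,r_1^-$ (in cyclic order, $M\ge 1$) in which $r_0,r_M$ have length $n^{1-\delta}$ and the $r_i^\pm$ have length $\tfrac12 n^{1-\delta}$, up to errors of at most $\varepsilon(n)n^{1-\delta}$, such that the prefix of $r_i^+$ of length $\lfloor C\log n\rfloor$ is inverse to the suffix of $r_i^-$ of this length ($1\le i<M$), and the prefix of $r_M$ of this length is inverse to its suffix; the prefixes and suffixes do not overlap. It is found by reading $r$ synchronously outwards in both directions from a location $o$: $p_0=0$, and the $(i+1)$-st pair of segments ($0\le i<M$) begins at the least distance $p_{i+1}\ge p_i+g_i$ from $o$ at which the segments of length $\lfloor C\log n\rfloor$ read on the two sides are mutually inverse. Here the $g_i$ are numbers fixed in advance with $|g_i-\tfrac12 n^{1-\delta}|\le\varepsilon(n)n^{1-\delta}$.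 Glue the mutually inverse prefixes and suffixes (the lips). This decomposes $r$ into tagged loops (beads) $B_0,\dots,B_M$, and likewise $r^{-1}$ into $B_0^{-1},\dots,B_M^{-1}$. Let a rule be given that pairs the letters of $N B_i\cup N B_i^{-1}$ with each other, giving a fatgraph $Y_i$ which depends only on $o$, $i$ and the (located) subwords $r_i^\pm$ (respectively $r_0$, $r_M$). Let $Y$ be the fatgraph obtained from the $Y_i$ and the lips of all copies of $r$ and $r^{-1}$, so that $\partial S(Y)$ consists of $N$ copies of $r$ and $N$ copies of $r^{-1}$, where $S(Y)$ is the fattening of $Y$. Then there is $c>0$, depending only on $k,L,N,C,\delta,\beta$, such that with probability $1-O(e^{-n^c})$, where the implied constant depends on these numbers and the function $\varepsilon$ but not on the $g_i$ or the rule, the following holds for every location $o$ and every bead decomposition of $r$ found in this way: if $Y$ is a labelled fatgraph over the rose which is trivalent with every edge of length at least $L$, then every path in $Y$ of length at least $\beta n$ whose label is a subword of the cyclic word $r$ or of $r^{-1}$ lies in $\partial S(Y)$, i.e. runs along a boundary component, in one of the two directions. -/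

import Mathlib

namespace Beads

/-- Letters `x₁^{±1}, …, x_k^{±1}` of the free group of rank `k`
(the convention is that of `FreeGroup (Fin k)`). -/
abbrev Letter (k : ℕ) := Fin k × Bool

/-- The inverse letter. -/
def linv {k : ℕ} (a : Letter k) : Letter k := (a.1, !a.2)

/-- Cyclically reduced words of length `n`, read on the cycle `ZMod n`. -/
def cycRed (k n : ℕ) : Set (ZMod n → Letter k) :=
  {r | ∀ x, r (x + 1) ≠ linv (r x)}

/-- Probability of the event `E` for a uniformly random cyclically reduced word of length `n`. -/
noncomputable def prob (k n : ℕ) (E : Set (ZMod n → Letter k)) : ℝ :=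
  ((cycRed k n ∩ E).ncard : ℝ) / ((cycRed k n).ncard : ℝ)

/-! ### Fatgraphs -/

/-- A fatgraph with set of oriented (unit) edges `D`: `rev` reverses an oriented edge, and `rot`
is the cyclic order on the oriented edges that issue from a common vertex; the vertices are
the cycles of `rot`. -/
structure Fatgraph (D : Type*) where
  rev : Equiv.Perm D
  rot : Equiv.Perm D
  rev_rev : ∀ d, rev (rev d) = d
  rev_ne : ∀ d, rev d ≠ d

namespace Fatgraph

variable {D : Type*} (Y : Fatgraph D)

/-- The oriented boundary of the fattening `S(Y)`: go along `d`, then turn to the oriented edge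
that follows `d` reversed in the cyclic order. The boundary components are the cycles. -/
def bdry (d : D) : D := Y.rot (Y.rev d)

/-- The valence of the initial vertex of `d`. -/
noncomputable def valence (d : D) : ℕ := Function.minimalPeriod Y.rot d

/-- After forgetting the vertices of valence two, which subdivide edges into unit edges, `Y` is
trivalent and every edge has length at least `L`. -/
def IsTrivalent (L : ℕ) : Prop :=
  (∀ d, Y.valence d = 2 ∨ Y.valence d = 3) ∧
    ∀ d, Y.valence d = 3 → ∀ j, 0 < j → j < L → Y.valence (Y.bdry^[j] d) = 2

/-- `γ 0, …, γ (m - 1)` is an edge path: each edge issues from the end of the preceding one. -/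
def IsPath (m : ℕ) (γ : ℕ → D) : Prop :=
  ∀ j, j + 1 < m → Y.rot.SameCycle (Y.rev (γ j)) (γ (j + 1))

/-- The path `γ 0, …, γ (m - 1)` lies in `∂S(Y)`: it runs along a boundary component, with the
orientation of the boundary or against it. -/
def InBoundary (m : ℕ) (γ : ℕ → D) : Prop :=
  (∀ j, j + 1 < m → γ (j + 1) = Y.bdry (γ j)) ∨
    ∀ j, j + 1 < m → Y.rev (γ j) = Y.bdry (Y.rev (γ (j + 1)))

end Fatgraph

/-! ### `N` copies of `r` and `N` copies of `r⁻¹` -/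

/-- The letters of `N` copies of `r` and `N` copies of `r⁻¹`: `(true, j, x)` is the letter of
the `j`-th copy of `r` at `x`, and `(false, j, x)` is its inverse in the `j`-th copy of `r⁻¹`. -/
abbrev Side (N n : ℕ) := Bool × Fin N × ZMod n

/-- The label of a letter of the `2N` loops. -/
def label {k N n : ℕ} (r : ZMod n → Letter k) (d : Side N n) : Letter k :=
  if d.1 then r d.2.2 else linv (r d.2.2)

/-- The next letter of the same loop; `r⁻¹` is read backwards. -/
def next {N n : ℕ} (d : Side N n) : Side N n :=
  if d.1 then (d.1, d.2.1, d.2.2 + 1) else (d.1, d.2.1, d.2.2 - 1)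

/-- The labels of the path `γ 0, …, γ (m - 1)` form a subword of the cyclic word `r` or of
the cyclic word `r⁻¹`. -/
def Appears {k N n : ℕ} (r : ZMod n → Letter k) (m : ℕ) (γ : ℕ → Side N n) : Prop :=
  (∃ s : ZMod n, ∀ j < m, label r (γ j) = r (s + (j : ZMod n))) ∨
    ∃ s : ZMod n, ∀ j < m, label r (γ j) = linv (r (s - (j : ZMod n)))

/-! ### Bead decompositions

The word is read outwards from a location `o`: the two letters at depth `t` are those at
`o + t` and `o - 1 - t`. -/

/-- The depth of the position `x`, measured from the location `o`. -/
def depth {n : ℕ} (o x : ZMod n) : ℕ := min (x - o).val (n - 1 - (x - o).val)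

/-- The position opposite to `x`: it exchanges `o + t` and `o - 1 - t`. -/
def mirror {n : ℕ} (o x : ZMod n) : ZMod n := o + o - 1 - x

/-- The length `C log n` of the lips. -/
noncomputable def lipLength (C : ℝ) (n : ℕ) : ℕ := ⌊C * Real.log n⌋₊

/-- The segments of length `l` which are read, outwards from depth `t`, on the two sides
of `o` are mutually inverse. -/
def MatchAt {k n : ℕ} (r : ZMod n → Letter k) (o : ZMod n) (l t : ℕ) : Prop :=
  ∀ a < l, r (o - 1 - ((t + a : ℕ) : ZMod n)) = linv (r (o + ((t + a : ℕ) : ZMod n)))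

/-- `p 1, …, p M` are the depths of the lips of a bead decomposition
`r₀, r₁⁺, …, r_{M-1}⁺, r_M, r_{M-1}⁻, …, r₁⁻` of `r` that is found by reading `r` outwards
from the location `o`. With `p 0 = 0`,
* `r₀` consists of the letters of depth `< p 1`,
* `rᵢ⁺` and `rᵢ⁻`, for `1 ≤ i < M`, consist of the letters of depth in `[p i, p (i + 1))`
  on the positive and on the negative side of `o`,
* `r_M` consists of the letters of depth `≥ p M`.

The search for the lip `i + 1` starts `gap i` letters beyond `p i`, and stops at the first pair
of mutually inverse segments of length `lipLength C n`. The number `ε` bounds the relative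
errors of the lengths. -/
structure IsBeadDecomposition {k n : ℕ} (C δ ε : ℝ) (gap : ℕ → ℕ) (r : ZMod n → Letter k)
    (o : ZMod n) (M : ℕ) (p : ℕ → ℕ) : Prop where
  pos : 1 ≤ M
  zero : p 0 = 0
  first : ∀ i < M, IsLeast {t | p i + gap i ≤ t ∧ MatchAt r o (lipLength C n) t} (p (i + 1))
  fits : ∀ i, 1 ≤ i → i < M → p i + lipLength C n ≤ p (i + 1)
  fits_last : 2 * (p M + lipLength C n) ≤ n
  length_zero : |2 * (p 1 : ℝ) - (n : ℝ) ^ (1 - δ)| ≤ ε * (n : ℝ) ^ (1 - δ)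
  length_mid : ∀ i, 1 ≤ i → i < M →
    |((p (i + 1) : ℝ) - p i) - (n : ℝ) ^ (1 - δ) / 2| ≤ ε * (n : ℝ) ^ (1 - δ)
  length_last : |((n : ℝ) - 2 * p M) - (n : ℝ) ^ (1 - δ)| ≤ ε * (n : ℝ) ^ (1 - δ)

/-- The index `i` of the segment(s) `r₀`, `rᵢ^±`, `r_M` that the position `x` belongs to. -/
def beadIndex {n : ℕ} (o : ZMod n) (M : ℕ) (p : ℕ → ℕ) (x : ZMod n) : ℕ :=
  Nat.findGreatest (fun i => p i ≤ depth o x) M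

/-- The position `x` belongs to a lip, i.e. to the first `l` letters of `rᵢ⁺` or
the last `l` letters of `rᵢ⁻` with `1 ≤ i < M`, or to the first or last `l` letters of `r_M`. -/
def IsLip {n : ℕ} (l : ℕ) (o : ZMod n) (M : ℕ) (p : ℕ → ℕ) (x : ZMod n) : Prop :=
  1 ≤ beadIndex o M p x ∧ depth o x < p (beadIndex o M p x) + l

/-- The subwords `rᵢ^±` of `r` (or `r₀`, `r_M`), and nothing else of `r`. -/
def beadWord {k n : ℕ} (r : ZMod n → Letter k) (o : ZMod n) (M : ℕ) (p : ℕ → ℕ) (i : ℕ) :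
    ZMod n → Option (Letter k) :=
  fun x => if beadIndex o M p x = i then some (r x) else none

/-- A rule that builds the fatgraph `Yᵢ` from the subwords `rᵢ^±` only: given the location `o`,
the index `i` and these subwords, it tells which letters of `N Bᵢ ∪ N Bᵢ⁻¹` are paired. -/
abbrev BeadRule (k N n : ℕ) :=
  ZMod n → ℕ → (ZMod n → Option (Letter k)) → Side N n → Side N n

/-- `Y` is the spine of the beaded surface that is obtained from a bead decomposition of `r` and
the fatgraphs `Yᵢ` built by the rule `R`. -/
structure IsBeadedSpine {k N n : ℕ} (L l : ℕ) (R : BeadRule k N n) (r : ZMod n → Letter k)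
    (o : ZMod n) (M : ℕ) (p : ℕ → ℕ) (Y : Fatgraph (Side N n)) : Prop where
  /-- `∂S(Y)` is the union of `N` copies of `r` and `N` copies of `r⁻¹`. -/
  bdry_eq : ∀ d, Y.bdry d = next d
  /-- The labels define a map of `Y` to the rose. -/
  label_rev : ∀ d, label r (Y.rev d) = linv (label r d)
  /-- In every copy of `r` and `r⁻¹` the two sides of each lip are glued to each other. -/
  rev_lip : ∀ s j x, IsLip l o M p x → Y.rev (s, j, x) = (s, j, mirror o x)
  /-- The rest is glued as the rule `R` says. -/
  rev_bead : ∀ d : Side N n, ¬ IsLip l o M p d.2.2 →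
    Y.rev d = R o (beadIndex o M p d.2.2) (beadWord r o M p (beadIndex o M p d.2.2)) d
  /-- Letters of `N Bᵢ ∪ N Bᵢ⁻¹` are glued to letters of `N Bᵢ ∪ N Bᵢ⁻¹`. -/
  rev_index : ∀ d : Side N n, ¬ IsLip l o M p d.2.2 →
    beadIndex o M p (Y.rev d).2.2 = beadIndex o M p d.2.2
  /-- `Y` is trivalent with all edges of length at least `L`. -/
  trivalent : Y.IsTrivalent L

end Beads

namespace Beads

variable {k n N : ℕ}

/-! ### Letters and positions -/

/-! The boundary loops are reduced and all valences are 2 or 3, so distinct edges issuing from a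
vertex have distinct labels (`eq_of_sameCycle_of_label_eq`). A path is therefore determined by its
label and one of its edges (`path_eq_of_label_eq`). It is enough to find one moment at which the
path traverses the very letter of `r` that it reads, in some copy of `r` or backwards in some copy
of `r⁻¹` (`inBoundary_of_sync`).

Such a moment comes from the lips. Fix a window length `w = ⌊n ^ η⌋`, larger than a lip and much
shorter than a bead. Suppose that no window of `w` letters of a bead can be read along a path
avoiding that bead. Then a path reading the letters around lip `i + 1` visits bead `i` shortly
before and bead `i + 1` shortly after. In between it crosses the lip from its beginning, and so
reads the lip word. Either it does so at the right moment, or the lip word also occurs at a nearby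
shifted depth, and the lip is bad (`exists_sync`). A path of length `β * n` passes more than `n ^ (δ
/ 2)` consecutive lips, and one good lip suffices.

Two counts show that the exceptions are rare. A reduced path has two continuations at each step, so
at most `2 * N * n * 2 ^ w` words are read off a bead, and the part of `Y` off the bead does not
depend on the window. The window itself has at least `(2 * k - 1) ^ (w - 2)` values, and `2 * k - 1
≥ 3` (`ncard_strayEvent_mul_le`). A bad lip is determined by the rest of `r` and a shift with `4 * w
+ 1` values, against a power of `n` with exponent at least `2 * η` for the lip word. One bad lip
thus costs a factor at most `e⁻¹`, and `K` consecutive ones at most `e ^ (-K)`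
(`ncard_badLipEvent_mul_pow_le`). A union bound over polynomially many choices finishes the proof.
-/

@[simp] lemma linv_linv (a : Letter k) : linv (linv a) = a := by
  simp [linv]

lemma linv_inj {a b : Letter k} : linv a = linv b ↔ a = b :=
  ⟨fun h => by rw [← linv_linv a, h, linv_linv], fun h => h ▸ rfl⟩

lemma ne_linv_comm {a b : Letter k} : a ≠ linv b ↔ b ≠ linv a :=
  ⟨fun h h' => h (by rw [h', linv_linv]), fun h h' => h (by rw [h', linv_linv])⟩

/-- The position at depth `t` on the positive or negative side of `o`. -/
def outPos (o : ZMod n) (σ : Bool) (t : ℕ) : ZMod n := if σ then o + t else o - 1 - t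

/-- The letter read outwards from `o` at depth `t`, on the positive or negative side. -/
def outward (r : ZMod n → Letter k) (o : ZMod n) (σ : Bool) (t : ℕ) : Letter k :=
  if σ then r (outPos o σ t) else linv (r (outPos o σ t))

lemma outward_eq_iff {r r' : ZMod n → Letter k} {o : ZMod n} {σ : Bool} {t : ℕ} :
    outward r o σ t = outward r' o σ t ↔ r (outPos o σ t) = r' (outPos o σ t) := by
  cases σ <;> simp [outward, linv_inj]

lemma outward_succ_ne {r : ZMod n → Letter k} (hr : r ∈ cycRed k n) (o : ZMod n) (σ : Bool)
    (t : ℕ) : outward r o σ (t + 1) ≠ linv (outward r o σ t) := by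
  cases σ
  · have h := hr (o - 1 - ((t + 1 : ℕ) : ZMod n))
    rw [show o - 1 - ((t + 1 : ℕ) : ZMod n) + 1 = o - 1 - (t : ZMod n) by push_cast; ring] at h
    simp only [outward, outPos, Bool.false_eq_true, if_false, linv_linv]
    exact fun h' => h h'.symm
  · have h := hr (o + (t : ZMod n))
    simpa [outward, outPos, add_assoc] using h

lemma matchAt_iff {r : ZMod n → Letter k} {o : ZMod n} {l t : ℕ} :
    MatchAt r o l t ↔ ∀ a < l, outward r o false (t + a) = outward r o true (t + a) := by
  unfold MatchAt
  refine forall₂_congr fun a _ => ?_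
  simp only [outward, outPos, Bool.false_eq_true, if_false, if_true]
  constructor
  · intro h; rw [h, linv_linv]
  · intro h; rw [← h, linv_linv]

lemma mirror_mirror (o x : ZMod n) : mirror o (mirror o x) = x := by
  unfold mirror; ring

lemma mirror_outPos (o : ZMod n) (σ : Bool) (t : ℕ) :
    mirror o (outPos o σ t) = outPos o (!σ) t := by
  cases σ <;> simp [mirror, outPos] <;> ring

lemma val_neg_one_sub [NeZero n] (y : ZMod n) : (-1 - y).val = n - 1 - y.val := by
  have hy := ZMod.val_lt y
  have h : (-1 - y : ZMod n) = ((n - 1 - y.val : ℕ) : ZMod n) := by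
    rw [Nat.cast_sub (by omega), Nat.cast_sub (by omega)]
    simp
  rw [h, ZMod.val_cast_of_lt (by omega)]

lemma depth_mirror [NeZero n] (o x : ZMod n) : depth o (mirror o x) = depth o x := by
  have hy := ZMod.val_lt (x - o)
  have h : mirror o x - o = -1 - (x - o) := by unfold mirror; ring
  unfold depth
  rw [h, val_neg_one_sub]
  omega

lemma depth_outPos [NeZero n] (o : ZMod n) (σ : Bool) {t : ℕ} (ht : 2 * t < n) :
    depth o (outPos o σ t) = t := by
  have key : depth o (outPos o true t) = t := by
    unfold depth
    simp only [outPos, if_true, add_sub_cancel_left]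
    rw [ZMod.val_cast_of_lt (by omega)]
    omega
  cases σ
  · rw [← Bool.not_true, ← mirror_outPos, depth_mirror, key]
  · exact key

lemma exists_eq_outPos [NeZero n] (o x : ZMod n) : ∃ σ, x = outPos o σ (depth o x) := by
  have hy := ZMod.val_lt (x - o)
  rcases le_total (x - o).val (n - 1 - (x - o).val) with h | h
  · refine ⟨true, ?_⟩
    simp [depth, outPos, min_eq_left h]
  · refine ⟨false, ?_⟩
    simp only [depth, outPos, min_eq_right h, Bool.false_eq_true, if_false]
    rw [Nat.cast_sub (by omega), Nat.cast_sub (by omega)]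
    simp
    ring

lemma outPos_true_ne_false [NeZero n] (o : ZMod n) {t t' : ℕ} (ht : 2 * t < n)
    (ht' : 2 * t' < n) (hne : 2 * t + 1 < n) : outPos o true t ≠ outPos o false t' := by
  intro h
  have h1 := depth_outPos o true ht
  have h2 := depth_outPos o false ht'
  rw [h, h2] at h1
  subst h1
  have h3 : (((2 * t' + 1 : ℕ)) : ZMod n) = 0 := by
    simp only [outPos, if_true, Bool.false_eq_true, if_false] at h
    push_cast
    linear_combination h
  rw [ZMod.natCast_eq_zero_iff] at h3
  exact absurd (Nat.le_of_dvd (by omega) h3) (by omega)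

/-- Going one step forward increases the depth only on the positive side. -/
lemma eq_outPos_of_depth_lt [NeZero n] {o x : ZMod n} {q : ℕ} (h1 : depth o x < q)
    (h2 : q ≤ depth o (x + 1)) : x + 1 = outPos o true q ∧ depth o (x + 1) = q := by
  have hy := ZMod.val_lt (x - o)
  have hx : x = o + ((x - o).val : ZMod n) := by simp
  set v := (x - o).val with hv
  rcases Nat.lt_or_ge (v + 1) n with h | h
  · have hv1 : (x + 1 - o).val = v + 1 := by
      rw [show x + 1 - o = ((v + 1 : ℕ) : ZMod n) by push_cast; rw [hv]; simp; ring,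
        ZMod.val_cast_of_lt h]
    unfold depth at h1 h2 ⊢
    rw [hv1] at h2 ⊢
    rw [← hv] at h1
    have hq : q = v + 1 := by omega
    refine ⟨?_, by omega⟩
    rw [hq, hx]
    simp [outPos, add_assoc]
  · have hv1 : x + 1 - o = 0 := by
      rw [show x + 1 - o = ((v + 1 : ℕ) : ZMod n) by push_cast; rw [hv]; simp; ring,
        show v + 1 = n by omega]
      simp
    unfold depth at h2
    rw [hv1] at h2
    simp at h2
    omega

/-! ### The boundary of the surface -/

/-- The preceding letter of the same loop. -/
def prev (d : Side N n) : Side N n :=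
  if d.1 then (d.1, d.2.1, d.2.2 - 1) else (d.1, d.2.1, d.2.2 + 1)

@[simp] lemma prev_next (d : Side N n) : prev (next d) = d := by
  obtain ⟨s, j, x⟩ := d
  cases s <;> simp [prev, next]

lemma label_next_ne {r : ZMod n → Letter k} (hr : r ∈ cycRed k n) (d : Side N n) :
    label r (next d) ≠ linv (label r d) := by
  obtain ⟨s, j, x⟩ := d
  cases s
  · have h := hr (x - 1)
    simp only [sub_add_cancel] at h
    simp only [label, next, Bool.false_eq_true, if_false, linv_linv]
    exact fun h' => h h'.symm
  · simpa [label, next] using hr x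

/-- The letter at the `t`-th place, read outwards along one of the loops. -/
def outSide (o : ZMod n) (s : Bool) (j : Fin N) (t : ℕ) : Side N n := (s, j, outPos o s t)

lemma label_outSide (r : ZMod n → Letter k) (o : ZMod n) (s : Bool) (j : Fin N) (t : ℕ) :
    label r (outSide o s j t) = outward r o s t := rfl

lemma next_outSide (o : ZMod n) (s : Bool) (j : Fin N) (t : ℕ) :
    next (outSide o s j t) = outSide o s j (t + 1) := by
  cases s <;> simp [next, outSide, outPos] <;> ring

/-- Copies of `r` run outwards on the positive side and copies of `r⁻¹` on the negative side, so the
flag of the loop is also the side. Reflection by `mirror` reduces the second case to the first. -/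
lemma next_eq_outSide [NeZero n] {o : ZMod n} {z : Side N n} {q : ℕ}
    (h1 : depth o z.2.2 < q) (h2 : q ≤ depth o (next z).2.2) :
    ∃ s j, next z = outSide o s j q := by
  obtain ⟨s, j, x⟩ := z
  refine ⟨s, j, ?_⟩
  cases s
  · have h3 : mirror o x + 1 = mirror o (x - 1) := by unfold mirror; ring
    have h4 := eq_outPos_of_depth_lt (o := o) (x := mirror o x) (q := q)
      (by rw [depth_mirror]; exact h1) (by rw [h3, depth_mirror]; exact h2)
    have h5 := congrArg (mirror o) h4.1
    rw [h3, mirror_mirror, mirror_outPos] at h5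
    simp [next, outSide, h5]
  · have h4 := eq_outPos_of_depth_lt (o := o) h1 h2
    simp [next, outSide, h4.1]

/-- Inward crossings take place on the side opposite to the outward ones of the same loop, hence the
`mirror`. -/
lemma eq_outSide_mirror [NeZero n] {o : ZMod n} {z : Side N n} {q : ℕ}
    (h1 : depth o (next z).2.2 < q) (h2 : q ≤ depth o z.2.2) :
    ∃ s j, z = (s, j, mirror o (outPos o s q)) := by
  obtain ⟨s, j, x⟩ := z
  refine ⟨s, j, ?_⟩
  cases s
  · have h4 := eq_outPos_of_depth_lt (o := o) (x := x - 1) (q := q) h1 (by simpa using h2)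
    have h5 := h4.1
    rw [sub_add_cancel] at h5
    rw [h5, mirror_outPos]; rfl
  · have h3 : mirror o (x + 1) + 1 = mirror o x := by unfold mirror; ring
    have h4 := eq_outPos_of_depth_lt (o := o) (x := mirror o (x + 1)) (q := q)
      (by rw [depth_mirror]; exact h1) (by rw [h3, depth_mirror]; exact h2)
    have h5 := congrArg (mirror o) h4.1
    rw [h3, mirror_mirror] at h5
    rw [h5]

/-! ### Fatgraphs with boundary prescribed -/

section Fatgraph

variable {Y : Fatgraph (Side N n)} {r : ZMod n → Letter k} {L : ℕ}

lemma rot_eq_next (hb : ∀ d, Y.bdry d = next d) (d : Side N n) : Y.rot d = next (Y.rev d) := by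
  rw [← hb, Fatgraph.bdry, Y.rev_rev]

/-- In a cycle of length at most three every element is the given one, its successor or its
predecessor. -/
lemma sameCycle_cases (hT : Y.IsTrivalent L) {e f : Side N n} (h : Y.rot.SameCycle e f) :
    f = e ∨ f = Y.rot e ∨ e = Y.rot f := by
  have h3 : Y.rot (Y.rot e) = e ∨ Y.rot (Y.rot (Y.rot e)) = e := by
    rcases hT.1 e with h2 | h2
    · left
      have := Function.iterate_minimalPeriod (f := Y.rot) (x := e)
      rw [Fatgraph.valence] at h2
      rw [h2] at this
      exact this
    · right
      have := Function.iterate_minimalPeriod (f := Y.rot) (x := e)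
      rw [Fatgraph.valence] at h2
      rw [h2] at this
      exact this
  let S : Set (Side N n) := {f | f = e ∨ f = Y.rot e ∨ e = Y.rot f}
  have hS : ∀ f, f ∈ S ↔ Y.rot f ∈ S := by
    intro f
    constructor
    · rintro (h | h | h)
      · exact Or.inr (Or.inl (by rw [h]))
      · rcases h3 with h3 | h3
        · exact Or.inl (by rw [h, h3])
        · exact Or.inr (Or.inr (by rw [h, h3]))
      · exact Or.inl h.symm
    · rintro (h | h | h)
      · exact Or.inr (Or.inr h.symm)
      · exact Or.inl (Y.rot.injective h)
      · rcases h3 with h3 | h3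
        · refine Or.inl (Y.rot.injective (Y.rot.injective ?_))
          rw [← h, h3]
        · refine Or.inr (Or.inl (Y.rot.injective (Y.rot.injective ?_)))
          rw [← h, h3]
  have hz : ∀ i : ℤ, (Y.rot ^ i) e ∈ S := by
    intro i
    induction i using Int.induction_on with
    | zero => exact Or.inl rfl
    | succ i ih =>
      rw [add_comm, zpow_add, zpow_one, Equiv.Perm.mul_apply]
      exact (hS _).1 ih
    | pred i ih =>
      refine (hS _).2 ?_
      rw [← Equiv.Perm.mul_apply, ← zpow_one_add]
      simpa using ih
  obtain ⟨i, rfl⟩ := h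
  exact hz i

/-- The edges `rev e` and `rot e` are consecutive on a boundary loop, and the loops are reduced
words. -/
lemma label_rot_ne (hr : r ∈ cycRed k n) (hb : ∀ d, Y.bdry d = next d)
    (hl : ∀ d, label r (Y.rev d) = linv (label r d)) (e : Side N n) :
    label r (Y.rot e) ≠ label r e := by
  rw [rot_eq_next hb]
  have h := label_next_ne hr (Y.rev e)
  rwa [hl, linv_linv] at h

/-- The labelling is locally injective at the vertices. -/
lemma eq_of_sameCycle_of_label_eq (hr : r ∈ cycRed k n) (hb : ∀ d, Y.bdry d = next d)
    (hl : ∀ d, label r (Y.rev d) = linv (label r d)) (hT : Y.IsTrivalent L) {e f : Side N n}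
    (h : Y.rot.SameCycle e f) (hef : label r e = label r f) : e = f := by
  rcases sameCycle_cases hT h with h | h | h
  · exact h.symm
  · rw [h] at hef
    exact absurd hef.symm (label_rot_ne hr hb hl e)
  · rw [h] at hef
    exact absurd hef (label_rot_ne hr hb hl f)

/-- A path is determined by its label and one of its edges. -/
lemma path_eq_of_label_eq (hr : r ∈ cycRed k n) (hb : ∀ d, Y.bdry d = next d)
    (hl : ∀ d, label r (Y.rev d) = linv (label r d)) (hT : Y.IsTrivalent L) {m : ℕ}
    {γ η : ℕ → Side N n} (hγ : Y.IsPath m γ) (hη : Y.IsPath m η)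
    (hlab : ∀ j < m, label r (γ j) = label r (η j)) {j₀ : ℕ} (hj₀ : j₀ < m)
    (h₀ : γ j₀ = η j₀) : ∀ j < m, γ j = η j := by
  have up : ∀ i, j₀ + i < m → γ (j₀ + i) = η (j₀ + i) := by
    intro i
    induction i with
    | zero => intro _; exact h₀
    | succ i ih =>
      intro hi
      have ih' := ih (by omega)
      have h1 := hγ (j₀ + i) (by omega)
      have h2 := hη (j₀ + i) (by omega)
      rw [ih'] at h1
      exact eq_of_sameCycle_of_label_eq hr hb hl hT (h1.symm.trans h2) (hlab _ (by omega))
  have down : ∀ i ≤ j₀, γ (j₀ - i) = η (j₀ - i) := by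
    intro i
    induction i with
    | zero => intro _; exact h₀
    | succ i ih =>
      intro hi
      have ih' := ih (by omega)
      have h1 := hγ (j₀ - (i + 1)) (by omega)
      have h2 := hη (j₀ - (i + 1)) (by omega)
      rw [show j₀ - (i + 1) + 1 = j₀ - i by omega] at h1 h2
      rw [ih'] at h1
      refine Y.rev.injective
        (eq_of_sameCycle_of_label_eq hr hb hl hT (h1.trans h2.symm) ?_)
      rw [hl, hl, hlab _ (by omega)]
  intro j hj
  rcases le_total j₀ j with h | h
  · have := up (j - j₀) (by omega)
    rwa [show j₀ + (j - j₀) = j by omega] at this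
  · have := down (j₀ - j) (by omega)
    rwa [show j₀ - (j₀ - j) = j by omega] at this

/-- A path which reads `r` is contained in the boundary as soon as one of its edges is. -/
lemma inBoundary_of_sync (hr : r ∈ cycRed k n) (hb : ∀ d, Y.bdry d = next d)
    (hl : ∀ d, label r (Y.rev d) = linv (label r d)) (hT : Y.IsTrivalent L) {m : ℕ}
    {γ : ℕ → Side N n} (hγ : Y.IsPath m γ) {s : ZMod n}
    (hlab : ∀ j < m, label r (γ j) = r (s + (j : ZMod n))) {j₀ : ℕ} (hj₀ : j₀ < m)
    {a : Fin N} (h₀ : γ j₀ = (true, a, s + (j₀ : ZMod n)) ∨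
      γ j₀ = Y.rev (false, a, s + (j₀ : ZMod n))) : Y.InBoundary m γ := by
  rcases h₀ with h₀ | h₀
  · have hη : ∀ j : ℕ, next ((true, a, s + (j : ZMod n)) : Side N n) =
        (true, a, s + ((j + 1 : ℕ) : ZMod n)) := by
      intro j; simp [next, add_assoc]
    have key := path_eq_of_label_eq hr hb hl hT hγ
      (η := fun j => (true, a, s + (j : ZMod n))) (fun j _ => by
        refine ⟨1, ?_⟩
        rw [zpow_one, rot_eq_next hb, Y.rev_rev, hη])
      (fun j hj => by rw [hlab j hj]; rfl) hj₀ h₀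
    left
    intro j hj
    rw [key _ hj, key j (by omega), hb, hη]
  · have hη : ∀ j : ℕ, next ((false, a, s + ((j + 1 : ℕ) : ZMod n)) : Side N n) =
        (false, a, s + (j : ZMod n)) := by
      intro j; simp [next]; ring
    have key := path_eq_of_label_eq hr hb hl hT hγ
      (η := fun j => Y.rev (false, a, s + (j : ZMod n))) (fun j _ => by
        refine Equiv.Perm.SameCycle.symm ⟨1, ?_⟩
        rw [zpow_one, rot_eq_next hb, Y.rev_rev, Y.rev_rev, hη])
      (fun j hj => by rw [hlab j hj, hl]; simp [label]) hj₀ h₀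
    right
    intro j hj
    rw [key _ hj, key j (by omega), hb, Y.rev_rev, Y.rev_rev, hη]

/-- A reduced path follows the boundary at each step, in one of the two directions. -/
lemma path_step (hb : ∀ d, Y.bdry d = next d)
    (hl : ∀ d, label r (Y.rev d) = linv (label r d)) (hT : Y.IsTrivalent L) {e f : Side N n}
    (h : Y.rot.SameCycle (Y.rev e) f) (hef : label r f ≠ linv (label r e)) :
    f = next e ∨ next (Y.rev f) = Y.rev e := by
  rcases sameCycle_cases hT h with h | h | h
  · rw [h, hl] at hef
    exact absurd rfl hef
  · left; rw [h, rot_eq_next hb, Y.rev_rev]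
  · right; rw [h, rot_eq_next hb]

lemma isPath_reverse {m : ℕ} {γ : ℕ → Side N n} (h : Y.IsPath m γ) :
    Y.IsPath m (fun j => Y.rev (γ (m - 1 - j))) := by
  intro j hj
  have h1 := h (m - 1 - (j + 1)) (by omega)
  rw [show m - 1 - (j + 1) + 1 = m - 1 - j by omega] at h1
  simpa only [Y.rev_rev] using h1.symm

lemma inBoundary_of_reverse {m : ℕ} {γ : ℕ → Side N n}
    (h : Y.InBoundary m (fun j => Y.rev (γ (m - 1 - j)))) : Y.InBoundary m γ := by
  rcases h with h | h
  · right
    intro j hj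
    have h1 := h (m - 1 - (j + 1)) (by omega)
    simp only at h1
    rwa [show m - 1 - (m - 1 - (j + 1) + 1) = j by omega,
      show m - 1 - (m - 1 - (j + 1)) = j + 1 by omega] at h1
  · left
    intro j hj
    have h1 := h (m - 1 - (j + 1)) (by omega)
    simp only [Y.rev_rev] at h1
    rwa [show m - 1 - (m - 1 - (j + 1) + 1) = j by omega,
      show m - 1 - (m - 1 - (j + 1)) = j + 1 by omega] at h1

end Fatgraph

/-! ### Bead indices -/

section BeadIndex

variable {o : ZMod n} {M : ℕ} {p : ℕ → ℕ}

lemma beadIndex_le (o : ZMod n) (M : ℕ) (p : ℕ → ℕ) (x : ZMod n) : beadIndex o M p x ≤ M :=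
  Nat.findGreatest_le M

lemma le_beadIndex_iff (h0 : p 0 = 0) (hp : MonotoneOn p (Set.Iic M)) {i : ℕ} (hi : i ≤ M)
    (x : ZMod n) : i ≤ beadIndex o M p x ↔ p i ≤ depth o x := by
  constructor
  · intro h
    have h1 : p (beadIndex o M p x) ≤ depth o x :=
      Nat.findGreatest_spec (P := fun i => p i ≤ depth o x) (Nat.zero_le M) (by simp [h0])
    exact (hp hi (beadIndex_le o M p x) h).trans h1
  · intro h
    exact Nat.le_findGreatest hi h

lemma beadIndex_congr {p' : ℕ → ℕ} (h : ∀ i ≤ M, p i = p' i) (x : ZMod n) :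
    beadIndex o M p x = beadIndex o M p' x := by
  unfold beadIndex
  induction M with
  | zero => simp
  | succ M ih =>
    rw [Nat.findGreatest_succ, Nat.findGreatest_succ, h (M + 1) le_rfl,
      ih fun i hi => h i (by omega)]

lemma beadIndex_eq_iff (h0 : p 0 = 0) (hp : MonotoneOn p (Set.Iic M)) {i : ℕ}
    (hi : i < M) {x : ZMod n} : beadIndex o M p x = i ↔ p i ≤ depth o x ∧ depth o x < p (i + 1) := by
  rw [← le_beadIndex_iff h0 hp hi.le, ← not_le, ← le_beadIndex_iff h0 hp hi]
  omega

lemma isLip_congr {l : ℕ} {p' : ℕ → ℕ} (h : ∀ i ≤ M, p i = p' i) (x : ZMod n) :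
    IsLip l o M p x ↔ IsLip l o M p' x := by
  unfold IsLip
  rw [← beadIndex_congr h, h _ (beadIndex_le o M p x)]

end BeadIndex

/-! ### Lips are determined by the letters outside one bead -/

section BeadDecomposition

variable {C δ ε : ℝ} {gap : ℕ → ℕ} {r : ZMod n → Letter k} {o : ZMod n} {M : ℕ} {p : ℕ → ℕ}

namespace IsBeadDecomposition

lemma le_succ (hd : IsBeadDecomposition C δ ε gap r o M p) {i : ℕ} (hi : i < M) :
    p i ≤ p (i + 1) := by
  rcases Nat.eq_zero_or_pos i with rfl | h
  · rw [hd.zero]; exact Nat.zero_le _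
  · exact (Nat.le_add_right _ _).trans (hd.fits i h hi)

lemma monotoneOn (hd : IsBeadDecomposition C δ ε gap r o M p) : MonotoneOn p (Set.Iic M) := by
  have key : ∀ j i, i + j ≤ M → p i ≤ p (i + j) := by
    intro j
    induction j with
    | zero => intro i _; exact le_rfl
    | succ j ih => intro i h; exact (ih i (by omega)).trans (hd.le_succ (i := i + j) (by omega))
  intro i _ j hj hij
  have := key (j - i) i (by have : j ≤ M := hj; omega)
  rwa [show i + (j - i) = j by omega] at this

lemma mono (hd : IsBeadDecomposition C δ ε gap r o M p) {i j : ℕ} (hij : i ≤ j) (hj : j ≤ M) :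
    p i ≤ p j :=
  hd.monotoneOn (show i ≤ M from hij.trans hj) hj hij

lemma add_lip_le (hd : IsBeadDecomposition C δ ε gap r o M p) {i j : ℕ} (hi : 1 ≤ i)
    (hij : i < j) (hj : j ≤ M) : p i + lipLength C n ≤ p j :=
  (hd.fits i hi (by omega)).trans (hd.mono (show i + 1 ≤ j from hij) hj)

lemma two_mul_add_le (hd : IsBeadDecomposition C δ ε gap r o M p) {i : ℕ} (hi : i ≤ M) :
    2 * (p i + lipLength C n) ≤ n := by
  have := hd.mono hi le_rfl
  have := hd.fits_last
  omega

lemma matchAt (hd : IsBeadDecomposition C δ ε gap r o M p) {i : ℕ} (hi : 1 ≤ i) (hM : i ≤ M) :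
    MatchAt r o (lipLength C n) (p i) := by
  have := (hd.first (i - 1) (by omega)).1.2
  rwa [show i - 1 + 1 = i by omega] at this

lemma beadIndex_eq (hd : IsBeadDecomposition C δ ε gap r o M p) {i : ℕ} (hi : i < M)
    {x : ZMod n} : beadIndex o M p x = i ↔ p i ≤ depth o x ∧ depth o x < p (i + 1) :=
  beadIndex_eq_iff hd.zero hd.monotoneOn hi

lemma le_beadIndex (hd : IsBeadDecomposition C δ ε gap r o M p) {i : ℕ} (hi : i ≤ M)
    {x : ZMod n} : i ≤ beadIndex o M p x ↔ p i ≤ depth o x :=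
  le_beadIndex_iff hd.zero hd.monotoneOn hi x

lemma isLip (hd : IsBeadDecomposition C δ ε gap r o M p) {i : ℕ} (hi : 1 ≤ i) (hM : i ≤ M)
    {x : ZMod n} (h1 : p i ≤ depth o x) (h2 : depth o x < p i + lipLength C n) :
    IsLip (lipLength C n) o M p x := by
  have h3 : beadIndex o M p x = i := by
    refine le_antisymm ?_ ((hd.le_beadIndex hM).2 h1)
    by_contra h
    push Not at h
    have h4 := (hd.le_beadIndex (beadIndex_le o M p x)).1 le_rfl
    have h5 := hd.add_lip_le hi h (beadIndex_le o M p x)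
    omega
  exact ⟨by rw [h3]; exact hi, by rw [h3]; exact h2⟩

/-- The depths of the lips are determined by the letters off one bead. -/
lemma eq_of_agree [NeZero n] {r' : ZMod n → Letter k} {p' : ℕ → ℕ}
    (hd : IsBeadDecomposition C δ ε gap r o M p) (hd' : IsBeadDecomposition C δ ε gap r' o M p')
    {i a b : ℕ} (hM : i ≤ M) (ha : p i + lipLength C n ≤ a) (hb : i < M → b ≤ p (i + 1))
    (ha' : p' i + lipLength C n ≤ a) (hb' : i < M → b ≤ p' (i + 1))
    (h : ∀ x, (depth o x < a ∨ b ≤ depth o x) → r x = r' x) : ∀ j ≤ M, p j = p' j := by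
  -- One inequality suffices, by symmetry. The next lip of `r'` avoids the depths in `[a, b)`, so it
  -- is also a match in `r`, and the search in `r` stops there at the latest.
  have key : ∀ {r r' : ZMod n → Letter k} {p p' : ℕ → ℕ},
      IsBeadDecomposition C δ ε gap r o M p → IsBeadDecomposition C δ ε gap r' o M p' →
      (p' i + lipLength C n ≤ a) → (i < M → b ≤ p' (i + 1)) →
      (∀ x, (depth o x < a ∨ b ≤ depth o x) → r x = r' x) → ∀ j < M, p j = p' j →
      p (j + 1) ≤ p' (j + 1) := by
    intro r r' p p' hd hd' ha' hb' h j hj hpj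
    refine (hd.first j hj).2 ⟨?_, ?_⟩
    · rw [hpj]; exact (hd'.first j hj).1.1
    · have hm := (hd'.first j hj).1.2
      rw [matchAt_iff] at hm ⊢
      intro c hc
      have hlt : 2 * (p' (j + 1) + c) < n := by
        have := hd'.two_mul_add_le (i := j + 1) hj
        omega
      have heq : ∀ σ, outward r o σ (p' (j + 1) + c) = outward r' o σ (p' (j + 1) + c) := by
        intro σ
        rw [outward_eq_iff]
        apply h
        rw [depth_outPos o σ hlt]
        rcases Nat.lt_or_ge i (j + 1) with hij | hij
        · right
          have h1 := hb' (by omega)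
          have h2 := hd'.mono (show i + 1 ≤ j + 1 from hij) hj
          omega
        · left
          have := hd'.mono hij hM
          omega
      rw [heq, heq]
      exact hm c hc
  intro j
  induction j with
  | zero => intro _; rw [hd.zero, hd'.zero]
  | succ j ih =>
    intro hj
    exact le_antisymm (key hd hd' ha' hb' h j hj (ih (by omega)))
      (key hd' hd ha hb (fun x hx => (h x hx).symm) j hj (ih (by omega)).symm)

end IsBeadDecomposition

end BeadDecomposition

/-! ### Paths crossing lips -/

/-- The `l` letters that are read outwards from depth `q` are also read from another depth,
at distance at most `2 * w` from `q`. -/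
def BadLip (r : ZMod n → Letter k) (o : ZMod n) (σ : Bool) (l w q : ℕ) : Prop :=
  ∃ q', q' ≠ q ∧ q ≤ q' + 2 * w ∧ q' ≤ q + 2 * w ∧
    ∀ t < l, outward r o σ (q' + t) = outward r o σ (q + t)

/-- The `w` letters that are read outwards from depth `t₀` can be read along a path in `Y`
that avoids the `i`-th bead. -/
def StrayRead (r : ZMod n → Letter k) (o : ZMod n) (M : ℕ) (p : ℕ → ℕ)
    (Y : Fatgraph (Side N n)) (σ : Bool) (i t₀ w : ℕ) : Prop :=
  ∃ g : ℕ → Side N n, Y.IsPath w g ∧ (∀ j < w, beadIndex o M p (g j).2.2 ≠ i) ∧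
    ∀ j < w, label r (g j) = outward r o σ (t₀ + j)

lemma isPath_shift {Y : Fatgraph (Side N n)} {m m' j₀ : ℕ} {γ : ℕ → Side N n}
    (h : Y.IsPath m γ) (hm : j₀ + m' ≤ m) : Y.IsPath m' (fun j => γ (j₀ + j)) := by
  intro j hj
  have := h (j₀ + j) (by omega)
  rwa [show j₀ + j + 1 = j₀ + (j + 1) by omega] at this

section Spine

variable {C δ ε : ℝ} {gap : ℕ → ℕ} {r : ZMod n → Letter k} {o : ZMod n} {M L : ℕ} {p : ℕ → ℕ}
  {R : BeadRule k N n} {Y : Fatgraph (Side N n)}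

namespace IsBeadedSpine

/-- Lips are glued by `mirror`, which preserves depth; all other letters are glued within their
bead. -/
lemma beadIndex_rev [NeZero n] {l : ℕ} (hY : IsBeadedSpine L l R r o M p Y) (d : Side N n) :
    beadIndex o M p (Y.rev d).2.2 = beadIndex o M p d.2.2 := by
  by_cases h : IsLip l o M p d.2.2
  · obtain ⟨s, j, x⟩ := d
    rw [hY.rev_lip s j x h]
    unfold beadIndex
    simp only [depth_mirror]
  · exact hY.rev_index d h

lemma rev_outSide [NeZero n] (hd : IsBeadDecomposition C δ ε gap r o M p)
    (hY : IsBeadedSpine L (lipLength C n) R r o M p Y) {i : ℕ} (hi : 1 ≤ i) (hM : i ≤ M)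
    {t : ℕ} (ht : t < lipLength C n) (s : Bool) (j : Fin N) :
    Y.rev (outSide o s j (p i + t)) = (s, j, mirror o (outPos o s (p i + t))) := by
  have h := hd.two_mul_add_le hM
  refine hY.rev_lip s j _ (hd.isLip hi hM ?_ ?_) <;> rw [depth_outPos _ _ (by omega)] <;> omega

/-- A path can only enter the beads beyond a lip at the beginning of that lip. -/
lemma crossing [NeZero n] (hd : IsBeadDecomposition C δ ε gap r o M p)
    (hY : IsBeadedSpine L (lipLength C n) R r o M p Y) (hl : 0 < lipLength C n) {i : ℕ}
    (hi : 1 ≤ i) (hM : i ≤ M) {e f : Side N n}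
    (h : Y.rot.SameCycle (Y.rev e) f) (hef : label r f ≠ linv (label r e))
    (he : depth o e.2.2 < p i) (hf : p i ≤ depth o f.2.2) :
    ∃ s j, f = outSide o s j (p i) := by
  rcases path_step hY.bdry_eq hY.label_rev hY.trivalent h hef with h1 | h1
  · rw [h1] at hf ⊢
    exact next_eq_outSide he hf
  -- Against the boundary, the reversed step goes inwards across depth `p i`. Its source is a letter
  -- of the lip, glued to the first letter of the opposite side.
  · have he' : depth o (next (Y.rev f)).2.2 < p i := by
      rw [h1, ← not_le, ← hd.le_beadIndex hM, hY.beadIndex_rev, hd.le_beadIndex hM, not_le]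
      exact he
    have hf' : p i ≤ depth o (Y.rev f).2.2 := by
      rwa [← hd.le_beadIndex hM, hY.beadIndex_rev, hd.le_beadIndex hM]
    obtain ⟨s, j, h2⟩ := eq_outSide_mirror he' hf'
    refine ⟨s, j, Y.rev.injective ?_⟩
    have h3 := hY.rev_outSide hd hi hM hl s j
    rw [add_zero] at h3
    rw [h2, h3]

/-- A path that enters a lip runs along it. -/
lemma along_lip [NeZero n] (hd : IsBeadDecomposition C δ ε gap r o M p)
    (hY : IsBeadedSpine L (lipLength C n) R r o M p Y) {i : ℕ} (hi : 1 ≤ i) (hM : i ≤ M)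
    {m : ℕ} {g : ℕ → Side N n} (hg : Y.IsPath m g)
    (hred : ∀ j, j + 1 < m → label r (g (j + 1)) ≠ linv (label r (g j))) {s : Bool} {a : Fin N}
    {j₁ : ℕ} (h₁ : g j₁ = outSide o s a (p i)) :
    ∀ t < lipLength C n, j₁ + t < m → g (j₁ + t) = outSide o s a (p i + t) := by
  intro t
  induction t with
  | zero => intro _ _; exact h₁
  | succ t ih =>
    intro ht hm
    have ih' := ih (by omega) (by omega)
    rcases path_step hY.bdry_eq hY.label_rev hY.trivalent (hg (j₁ + t) (by omega))
      (hred _ (by omega)) with h1 | h1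
    · rw [← add_assoc, h1, ih', next_outSide, add_assoc]
    -- Since the two sides of the lip are glued letter by letter, going against the boundary leads
    -- to the same edge as going along it.
    · have h2 := congrArg prev h1
      rw [prev_next, ih', hY.rev_outSide hd hi hM (by omega)] at h2
      refine Y.rev.injective ?_
      rw [← add_assoc j₁, h2, hY.rev_outSide hd hi hM ht, mirror_outPos, mirror_outPos]
      cases s <;> simp [prev, outPos] <;> ring

/-- The two sides of a lip read the same outwards, so the word read does not depend on the side on
which the path enters. -/
lemma label_along_lip {i : ℕ} (hd : IsBeadDecomposition C δ ε gap r o M p) (hi : 1 ≤ i)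
    (hM : i ≤ M) {t : ℕ} (ht : t < lipLength C n) (s σ : Bool) (a : Fin N) :
    label r (outSide o s a (p i + t)) = outward r o σ (p i + t) := by
  have h := matchAt_iff.1 (hd.matchAt hi hM) t ht
  rw [label_outSide]
  cases s <;> cases σ <;> simp [h]

/-- A path that reads `r` outwards along a long segment is contained in the boundary where
it enters a good lip. -/
lemma exists_sync [NeZero n] (hr : r ∈ cycRed k n) (hd : IsBeadDecomposition C δ ε gap r o M p)
    (hY : IsBeadedSpine L (lipLength C n) R r o M p Y) (hl : 0 < lipLength C n) {w : ℕ}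
    (hw : lipLength C n ≤ w) (hlong : ∀ i, 1 ≤ i → i < M → p i + 4 * w ≤ p (i + 1)) {σ : Bool}
    {t₀ b : ℕ} {g : ℕ → Side N n} (hg : Y.IsPath b g)
    (hlab : ∀ j < b, label r (g j) = outward r o σ (t₀ + j)) {i : ℕ} (hi : 1 ≤ i)
    (hM : i + 1 < M) (ht₀ : t₀ ≤ p i) (hb : p (i + 2) ≤ t₀ + b)
    (h1 : ¬ StrayRead r o M p Y σ i (p (i + 1) - w) w)
    (h2 : ¬ StrayRead r o M p Y σ (i + 1) (p (i + 1) + lipLength C n) w)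
    (h3 : ¬ BadLip r o σ (lipLength C n) w (p (i + 1))) :
    ∃ j < b, t₀ + j = p (i + 1) ∧ ∃ s a, g j = outSide o s a (p (i + 1)) := by
  have hi1 := hlong i hi (by omega)
  have hi2 := hlong (i + 1) (by omega) hM
  rw [show i + 1 + 1 = i + 2 by omega] at hi2
  have hred : ∀ j, j + 1 < b → label r (g (j + 1)) ≠ linv (label r (g j)) := by
    intro j hj
    rw [hlab _ hj, hlab j (by omega), ← add_assoc]
    exact outward_succ_ne hr o σ _
  -- Otherwise the last `w` letters before the lip would be read off bead `i`; similarly below for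
  -- the `w` letters after the lip and bead `i + 1`.
  obtain ⟨jA, hA1, hA2, hA3⟩ : ∃ j, p (i + 1) - w ≤ t₀ + j ∧ t₀ + j < p (i + 1) ∧
      beadIndex o M p (g j).2.2 = i := by
    by_contra hcon
    push Not at hcon
    refine h1 ⟨fun j => g (p (i + 1) - w - t₀ + j), isPath_shift hg (by omega), ?_, ?_⟩
    · intro j hj
      exact hcon _ (by omega) (by omega)
    · intro j hj
      rw [hlab _ (by omega)]
      congr 1
      omega
  obtain ⟨jB, hB1, hB2, hB3⟩ : ∃ j, p (i + 1) + lipLength C n ≤ t₀ + j ∧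
      t₀ + j < p (i + 1) + lipLength C n + w ∧ beadIndex o M p (g j).2.2 = i + 1 := by
    by_contra hcon
    push Not at hcon
    refine h2 ⟨fun j => g (p (i + 1) + lipLength C n - t₀ + j), isPath_shift hg (by omega),
      ?_, ?_⟩
    · intro j hj
      exact hcon _ (by omega) (by omega)
    · intro j hj
      rw [hlab _ (by omega)]
      congr 1
      omega
  have hA4 : depth o (g jA).2.2 < p (i + 1) := by
    rw [← not_le, ← hd.le_beadIndex (by omega)]; omega
  have hB4 : p (i + 1) ≤ depth o (g jB).2.2 := by
    rw [← hd.le_beadIndex (by omega)]; omega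
  obtain ⟨j, hj1, hj2, hj3, hj4⟩ : ∃ j, jA ≤ j ∧ j < jB ∧ depth o (g j).2.2 < p (i + 1) ∧
      p (i + 1) ≤ depth o (g (j + 1)).2.2 := by
    by_contra hcon
    push Not at hcon
    have : ∀ c, jA + c ≤ jB → depth o (g (jA + c)).2.2 < p (i + 1) := by
      intro c
      induction c with
      | zero => intro _; exact hA4
      | succ c ih => intro hc; exact hcon (jA + c) (Nat.le_add_right _ _) (by omega) (ih (by omega))
    have h4 := this (jB - jA) (by omega)
    rw [show jA + (jB - jA) = jB by omega] at h4
    omega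
  obtain ⟨s, a, hs⟩ := crossing hd hY hl (by omega) (by omega) (hg j (by omega))
    (hred j (by omega)) hj3 hj4
  refine ⟨j + 1, by omega, ?_, s, a, hs⟩
  by_contra hne
  -- The crossing lies between the two visits, so the shift is at most `w` plus a lip length, hence
  -- at most `2 * w`.
  refine h3 ⟨t₀ + (j + 1), hne, by omega, by omega, fun t ht => ?_⟩
  rw [add_assoc, ← hlab _ (by omega), along_lip hd hY (by omega) (by omega) hg hred hs t ht
    (by omega), label_along_lip hd (by omega) (by omega) ht]

end IsBeadedSpine

end Spine

/-! ### Long paths reading `r` lie in the boundary -/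

section Spine

variable {C δ ε : ℝ} {gap : ℕ → ℕ} {r : ZMod n → Letter k} {o : ZMod n} {M L : ℕ} {p : ℕ → ℕ}
  {R : BeadRule k N n} {Y : Fatgraph (Side N n)}

/-- Every long interval of depths contains many beads. -/
lemma IsBeadDecomposition.exists_beads (hd : IsBeadDecomposition C δ ε gap r o M p)
    {D b t₀ K : ℕ} (hD : ∀ i < M, p (i + 1) ≤ p i + D) (hDM : n ≤ 2 * (p M + D))
    (hb : (K + 4) * D ≤ b) (ht₀ : 2 * (t₀ + b) ≤ n) (hn : 0 < b) :
    ∃ A, 1 ≤ A ∧ A + K + 1 ≤ M ∧ t₀ ≤ p A ∧ p (A + K + 1) ≤ t₀ + b := by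
  have hKD : (K + 4) * D = K * D + 4 * D := by ring
  have hM : 1 ≤ M ∧ t₀ ≤ p M := ⟨hd.pos, by omega⟩
  have hex : ∃ A, 1 ≤ A ∧ t₀ ≤ p A := ⟨M, hM⟩
  classical
  have hA := Nat.find_spec hex
  have hAM : Nat.find hex ≤ M := Nat.find_min' hex hM
  have hAmin : ∀ i, i < Nat.find hex → ¬ (1 ≤ i ∧ t₀ ≤ p i) := fun i hi => Nat.find_min hex hi
  generalize Nat.find hex = A at hA hAM hAmin
  have hA1 : p A ≤ t₀ + D := by
    have h1 := hD (A - 1) (by omega)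
    rw [show A - 1 + 1 = A by omega] at h1
    rcases Nat.lt_or_ge 1 A with h | h
    · have := hAmin (A - 1) (by omega)
      omega
    · rw [show A - 1 = 0 by omega, hd.zero] at h1
      omega
  have hstep : ∀ j, A + j ≤ M → p (A + j) ≤ t₀ + (j + 1) * D := by
    intro j
    induction j with
    | zero => intro _; simpa using hA1
    | succ j ih =>
      intro hj
      have h1 := ih (by omega)
      have h2 := hD (A + j) (by omega)
      rw [show A + (j + 1) = A + j + 1 by omega]
      have : (j + 1 + 1) * D = (j + 1) * D + D := by ring
      omega
  -- The last lip has depth at least `t₀ + (K + 3) * D`, whereas with fewer beads it would have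
  -- depth at most `t₀ + (K + 1) * D`.
  have hM' : A + K + 1 ≤ M := by
    by_contra hcon
    have h1 := hstep (M - A) (by omega)
    rw [show A + (M - A) = M by omega] at h1
    have h2 : (M - A + 1) * D ≤ (K + 1) * D := Nat.mul_le_mul_right _ (by omega)
    have h3 : (K + 1) * D = K * D + D := by ring
    rcases Nat.eq_zero_or_pos D with rfl | hD0
    · simp only [mul_zero] at *
      omega
    · omega
  refine ⟨A, hA.1, hM', hA.2, ?_⟩
  have h1 := hstep (K + 1) (by omega)
  have h3 : (K + 1 + 1) * D = K * D + 2 * D := by ring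
  rw [← add_assoc] at h1
  omega

variable [NeZero n] (hr : r ∈ cycRed k n) (hd : IsBeadDecomposition C δ ε gap r o M p)
  (hY : IsBeadedSpine L (lipLength C n) R r o M p Y) (hl : 0 < lipLength C n) {w : ℕ}
  (hw : lipLength C n ≤ w) (hlong : ∀ i, 1 ≤ i → i < M → p i + 4 * w ≤ p (i + 1))
  {D b K : ℕ} (hD : ∀ i < M, p (i + 1) ≤ p i + D) (hDM : n ≤ 2 * (p M + D))
  (hKb : (K + 4) * D ≤ b) (hb0 : 0 < b)
  (hstray : ∀ σ i t, 1 ≤ i → i < M → p i + lipLength C n ≤ t → t + w ≤ p (i + 1) →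
    ¬ StrayRead r o M p Y σ i t w)
  (hlip : ∀ σ i, 1 ≤ i → i + K ≤ M → ∃ j < K, ¬ BadLip r o σ (lipLength C n) w (p (i + j)))

include hr hd hY hl hw hlong hD hDM hKb hb0 hstray hlip

/-- The path reads across `K` consecutive lips together with the beads on both sides of each, and
one of these lips is good. The reversed edge is recorded too because the crossing may occur in a
copy of `r` or of `r⁻¹`. -/
lemma exists_sync_of_outward {σ : Bool} {t₀ : ℕ} {g : ℕ → Side N n} (hg : Y.IsPath b g)
    (hlab : ∀ j < b, label r (g j) = outward r o σ (t₀ + j)) (ht₀ : 2 * (t₀ + b) ≤ n) :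
    ∃ j < b, ∃ s a, g j = outSide o s a (t₀ + j) ∧
      Y.rev (g j) = (s, a, outPos o (!s) (t₀ + j)) := by
  obtain ⟨A, hA1, hAM, hA2, hA3⟩ := hd.exists_beads hD hDM hKb ht₀ hb0
  obtain ⟨c, hc, hgood⟩ := hlip σ (A + 1) (by omega) (by omega)
  rw [show A + 1 + c = A + c + 1 by omega] at hgood
  have e1 := hlong (A + c) (by omega) (by omega)
  have e2 := hlong (A + c + 1) (by omega) (by omega)
  obtain ⟨j, hj, hj1, s, a, hja⟩ := IsBeadedSpine.exists_sync hr hd hY hl hw hlong hg hlab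
    (i := A + c) (by omega) (by omega) (hA2.trans (hd.mono (by omega) (by omega)))
    ((hd.mono (by omega) (by omega)).trans hA3)
    (hstray _ _ _ (by omega) (by omega) (by omega) (by omega))
    (hstray _ _ _ (by omega) (by omega) (by omega) (by omega)) hgood
  refine ⟨j, hj, s, a, by rw [hja, hj1], ?_⟩
  have := hY.rev_outSide hd (i := A + c + 1) (by omega) (by omega) hl s a
  rw [add_zero] at this
  rw [hja, this, hj1, mirror_outPos]

/-- Some block of `b` letters stays on one half of the circle cut at `o` and opposite to `o`. It is
the first block, or the block starting at the passage through `o`, both read outwards; otherwise it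
is the second block, which is read inwards on the negative side and has to be reversed. In every
case `3 * b` letters suffice. -/
lemma inBoundary_of_read {m : ℕ} (hbm : 3 * b ≤ m) (hbn : 2 * b ≤ n) {γ : ℕ → Side N n}
    (hγ : Y.IsPath m γ) {s : ZMod n} (hlab : ∀ j < m, label r (γ j) = r (s + (j : ZMod n))) :
    Y.InBoundary m γ := by
  have hv := ZMod.val_lt (s - o)
  have hs : s = o + ((s - o).val : ZMod n) := by simp
  set v := (s - o).val with hvdef
  have hfwd : ∀ t₀ j₀ : ℕ, j₀ + b ≤ m → s + (j₀ : ZMod n) = o + (t₀ : ZMod n) →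
      2 * (t₀ + b) ≤ n → Y.InBoundary m γ := by
    intro t₀ j₀ hj₀ hst ht
    have hpos : ∀ j : ℕ, s + ((j₀ + j : ℕ) : ZMod n) = outPos o true (t₀ + j) := by
      intro j
      simp only [outPos, if_true]
      push_cast
      rw [← add_assoc, hst, add_assoc]
    obtain ⟨j, hj, u, a, h1, h2⟩ := exists_sync_of_outward hr hd hY hl hw hlong hD hDM hKb hb0
      hstray hlip (σ := true) (isPath_shift hγ hj₀)
      (fun j hj => by rw [hlab _ (by omega), hpos]; rfl) ht
    refine inBoundary_of_sync hr hY.bdry_eq hY.label_rev hY.trivalent hγ hlab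
      (j₀ := j₀ + j) (by omega) (a := a) ?_
    rw [hpos]
    cases u
    · right
      rw [← Y.rev_rev (γ (j₀ + j)), h2]
      rfl
    · left; exact h1
  by_cases h1 : 2 * (v + b) ≤ n
  · exact hfwd v 0 (by omega) (by simpa using hs) h1
  by_cases h3 : n < v + 2 * b
  · refine hfwd 0 (n - v) (by omega) ?_ (by omega)
    rw [Nat.cast_sub hv.le, hs]
    simp
  · have hpos : ∀ j, j < b → s + ((b + (b - 1 - j) : ℕ) : ZMod n) =
        outPos o false (n - (v + 2 * b) + j) := by
      intro j hj
      have e : ((n - (v + 2 * b) + j : ℕ) : ZMod n) + ((b + (b - 1 - j) : ℕ) : ZMod n) =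
          -1 - (v : ZMod n) := by
        rw [← Nat.cast_add, show n - (v + 2 * b) + j + (b + (b - 1 - j)) = n - 1 - v by omega,
          Nat.cast_sub (by omega), Nat.cast_sub (by omega)]
        simp
      simp only [outPos, Bool.false_eq_true, if_false]
      rw [hs]
      linear_combination e
    obtain ⟨j, hj, u, a, h1, h2⟩ := exists_sync_of_outward hr hd hY hl hw hlong hD hDM hKb hb0
      hstray hlip (σ := false) (isPath_reverse (isPath_shift hγ (j₀ := b) (m' := b) (by omega)))
      (t₀ := n - (v + 2 * b))
      (fun j hj => by
        rw [hY.label_rev, hlab _ (by omega), hpos j hj]; rfl) (by omega)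
    refine inBoundary_of_sync hr hY.bdry_eq hY.label_rev hY.trivalent hγ hlab
      (j₀ := b + (b - 1 - j)) (by omega) (a := a) ?_
    rw [hpos j hj]
    cases u
    · right
      rw [← Y.rev_rev (γ _), h1]
      rfl
    · left
      rw [← Y.rev_rev (γ _), h2]
      rfl

lemma inBoundary_of_appears {m : ℕ} (hbm : 3 * b ≤ m) (hbn : 2 * b ≤ n) {γ : ℕ → Side N n}
    (hγ : Y.IsPath m γ) (ha : Appears r m γ) : Y.InBoundary m γ := by
  rcases ha with ⟨s, hs⟩ | ⟨s, hs⟩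
  · exact inBoundary_of_read hr hd hY hl hw hlong hD hDM hKb hb0 hstray hlip hbm hbn hγ hs
  · refine inBoundary_of_reverse (inBoundary_of_read hr hd hY hl hw hlong hD hDM hKb hb0 hstray
      hlip hbm hbn (isPath_reverse hγ) (s := s - ((m - 1 : ℕ) : ZMod n)) fun j hj => ?_)
    rw [hY.label_rev, hs _ (by omega), linv_linv, Nat.cast_sub (show j ≤ m - 1 by omega)]
    congr 1
    ring

end Spine

/-! ### Counting reduced words -/

/-- Words which are reduced. -/
def RedChain (w : List (Letter k)) : Prop := w.IsChain (fun a b => b ≠ linv a)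

lemma card_letter_sub_le (A : Finset (Letter k)) : 2 * k - A.card ≤ (Aᶜ).card := by
  rw [Finset.card_compl]
  simp
  omega

/-- Every letter but the last has `2 * k - 1` choices. The last one avoids at most three letters,
which is possible as `2 * k ≥ 4`. -/
lemma exists_chains (hk : 2 ≤ k) (B : Finset (Letter k)) (hB : B.card ≤ 2) (j : ℕ) :
    ∀ a : Letter k, ∃ S : Finset (List (Letter k)), (2 * k - 1) ^ j ≤ S.card ∧
      ∀ w ∈ S, w.length = j + 1 ∧ RedChain (a :: w) ∧ ∀ b ∈ w.getLast?, b ∉ B := by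
  induction j with
  | zero =>
    intro a
    have h := card_letter_sub_le (insert (linv a) B)
    have h' := Finset.card_insert_le (linv a) B
    obtain ⟨b, hb⟩ : ((insert (linv a) B)ᶜ).Nonempty := Finset.card_pos.1 (by omega)
    simp only [Finset.mem_compl, Finset.mem_insert, not_or] at hb
    refine ⟨{[b]}, by simp, ?_⟩
    intro w hw
    rw [Finset.mem_singleton] at hw
    subst hw
    simpa [RedChain] using hb
  | succ j ih =>
    intro a
    choose S hS1 hS2 using ih
    refine ⟨({linv a}ᶜ : Finset (Letter k)).biUnion fun b => (S b).image (List.cons b), ?_, ?_⟩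
    · rw [Finset.card_biUnion]
      · have h := card_letter_sub_le ({linv a} : Finset (Letter k))
        rw [Finset.card_singleton] at h
        calc (2 * k - 1) ^ (j + 1) = (2 * k - 1) * (2 * k - 1) ^ j := pow_succ' _ _
          _ ≤ ({linv a}ᶜ : Finset (Letter k)).card * (2 * k - 1) ^ j :=
            Nat.mul_le_mul_right _ h
          _ = ∑ b ∈ ({linv a}ᶜ : Finset (Letter k)), (2 * k - 1) ^ j := by simp
          _ ≤ _ := Finset.sum_le_sum fun b _ => by
            rw [Finset.card_image_of_injective _ (List.cons_injective)]
            exact hS1 b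
      · intro b _ c _ hbc
        rw [Function.onFun, Finset.disjoint_left]
        intro w hw hw'
        rw [Finset.mem_image] at hw hw'
        obtain ⟨u, _, rfl⟩ := hw
        obtain ⟨v, _, hv⟩ := hw'
        exact hbc (List.cons.inj hv).1.symm
    · intro w hw
      simp only [Finset.mem_biUnion, Finset.mem_image, Finset.mem_compl,
        Finset.mem_singleton] at hw
      obtain ⟨b, hb, u, hu, rfl⟩ := hw
      obtain ⟨h1, h2, h3⟩ := hS2 b u hu
      refine ⟨by simp [h1], ?_, ?_⟩
      · exact List.isChain_cons_cons.2 ⟨hb, h2⟩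
      · intro c hc
        have hne : u ≠ [] := by rintro rfl; simp at h1
        refine h3 c ?_
        rw [List.getLast?_cons] at hc
        rw [List.getLast?_eq_getLast_of_ne_nil hne] at hc ⊢
        simpa using hc

/-- There are many reduced words whose first and last letters avoid given ones. -/
lemma exists_words (hk : 2 ≤ k) (A B : Finset (Letter k)) (hA : A.card ≤ 2) (hB : B.card ≤ 2)
    {l : ℕ} (hl : 2 ≤ l) : ∃ S : Finset (List (Letter k)), (2 * k - 1) ^ (l - 2) ≤ S.card ∧
      ∀ w ∈ S, w.length = l ∧ RedChain w ∧ (∀ a ∈ w.head?, a ∉ A) ∧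
        ∀ b ∈ w.getLast?, b ∉ B := by
  have h := card_letter_sub_le A
  obtain ⟨a, ha⟩ : Aᶜ.Nonempty := Finset.card_pos.1 (by omega)
  rw [Finset.mem_compl] at ha
  obtain ⟨S, hS1, hS2⟩ := exists_chains hk B hB (l - 2) a
  refine ⟨S.image (List.cons a), ?_, ?_⟩
  · rwa [Finset.card_image_of_injective _ (List.cons_injective)]
  · intro w hw
    rw [Finset.mem_image] at hw
    obtain ⟨u, hu, rfl⟩ := hw
    obtain ⟨h1, h2, h3⟩ := hS2 u hu
    refine ⟨by simp [h1]; omega, h2, by simpa using ha, ?_⟩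
    intro c hc
    have hne : u ≠ [] := by rintro rfl; simp at h1
    refine h3 c ?_
    rw [List.getLast?_cons] at hc
    rw [List.getLast?_eq_getLast_of_ne_nil hne] at hc ⊢
    simpa using hc

/-! ### Replacing a subword -/

/-- The cyclic word `r` with the letters from `x` on replaced by the word `w`. -/
def splice (r : ZMod n → Letter k) (x : ZMod n) (w : List (Letter k)) : ZMod n → Letter k :=
  fun y => w.getD (y - x).val (r y)

lemma splice_of_le {r : ZMod n → Letter k} {x y : ZMod n} {w : List (Letter k)}
    (h : w.length ≤ (y - x).val) : splice r x w y = r y :=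
  List.getD_eq_default _ _ h

lemma splice_add [NeZero n] {r : ZMod n → Letter k} {x : ZMod n} {w : List (Letter k)} {t : ℕ}
    (hw : w.length ≤ n) (ht : t < w.length) : splice r x w (x + t) = w[t] := by
  unfold splice
  rw [add_sub_cancel_left, ZMod.val_cast_of_lt (by omega), List.getD_eq_getElem _ _ ht]

lemma splice_mem_cycRed [NeZero n] {r : ZMod n → Letter k} (hr : r ∈ cycRed k n) {x : ZMod n}
    {w : List (Letter k)} (hw : w.length < n) (hne : w ≠ []) (hc : RedChain w)
    (hhead : ∀ a ∈ w.head?, a ≠ linv (r (x - 1)))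
    (hlast : ∀ b ∈ w.getLast?, b ≠ linv (r (x + (w.length : ZMod n)))) :
    splice r x w ∈ cycRed k n := by
  have hpos : 0 < w.length := List.length_pos_of_ne_nil hne
  intro y
  have hv := ZMod.val_lt (y - x)
  have hy : y = x + ((y - x).val : ZMod n) := by simp
  generalize (y - x).val = v at hv hy
  have hy1 : y + 1 = x + ((v + 1 : ℕ) : ZMod n) := by rw [hy]; push_cast; ring
  have hval : ∀ u < n, (x + (u : ZMod n) - x).val = u := by
    intro u hu
    rw [add_sub_cancel_left, ZMod.val_cast_of_lt hu]
  rcases Nat.lt_or_ge (v + 1) w.length with h | h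
  · rw [hy1, hy, splice_add hw.le h, splice_add hw.le (by omega)]
    exact List.isChain_iff_getElem.1 hc v (by omega)
  rcases Nat.lt_or_ge v w.length with h' | h'
  · have hvw : v + 1 = w.length := by omega
    rw [hy1, hy, splice_add hw.le h', splice_of_le (by rw [hval _ (by omega)]; omega), hvw]
    refine ne_linv_comm.1 (hlast _ ?_)
    rw [List.getLast?_eq_getLast_of_ne_nil hne, Option.mem_some_iff, List.getLast_eq_getElem]
    congr 1
    omega
  · have h1 : splice r x w y = r y := splice_of_le (by rw [hy, hval _ hv]; exact h')
    rcases Nat.lt_or_ge (v + 1) n with h2 | h2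
    · rw [h1, splice_of_le (by rw [hy1, hval _ h2]; omega)]
      exact hr y
    · have h3 : y + 1 = x := by
        rw [hy1, show v + 1 = n by omega]; simp
      have h4 : splice r x w x = w[0] := by
        have := splice_add (r := r) (x := x) hw.le hpos
        simpa using this
      rw [h1, h3, h4]
      have h5 : y = x - 1 := by rw [← h3]; ring
      rw [h5]
      refine hhead _ ?_
      rw [List.head?_eq_some_head hne, Option.mem_some_iff, List.head_eq_getElem]

lemma splice_injective [NeZero n] {r : ZMod n → Letter k} {x : ZMod n} {w w' : List (Letter k)}
    (hw : w.length ≤ n) (hww : w.length = w'.length) (h : splice r x w = splice r x w') :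
    w = w' := by
  refine List.ext_getElem hww fun t h1 h2 => ?_
  rw [← splice_add (r := r) (x := x) hw h1, h, splice_add (by omega) h2]

/-! ### Double counting -/

lemma ncard_mul_le_ncard_mul {α : Type*} [Finite α] (E F : Set α) (Rel : α → α → Prop) {a b : ℕ}
    (ha : ∀ r ∈ E, a ≤ {r' ∈ F | Rel r r'}.ncard)
    (hb : ∀ r' ∈ F, {r ∈ E | Rel r r'}.ncard ≤ b) : E.ncard * a ≤ F.ncard * b := by
  classical
  have := Fintype.ofFinite α
  rw [Set.ncard_eq_toFinset_card' E, Set.ncard_eq_toFinset_card' F]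
  refine Finset.card_mul_le_card_mul Rel (fun r hr => ?_) (fun r' hr' => ?_)
  · refine (ha r (by simpa using hr)).trans (le_of_eq ?_)
    rw [Set.ncard_eq_toFinset_card']
    congr 1
    ext r'
    simp [Finset.bipartiteAbove]
  · refine le_trans (le_of_eq ?_) (hb r' (by simpa using hr'))
    rw [Set.ncard_eq_toFinset_card']
    congr 1
    ext r
    simp [Finset.bipartiteBelow]

/-- A word may have several codes; it only matters that no code serves two words. -/
lemma ncard_le_card_of_code {α β : Type*} [Fintype β] {T : Set α} (Code : α → β → Prop)
    (h1 : ∀ r ∈ T, ∃ b, Code r b)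
    (h2 : ∀ r ∈ T, ∀ r' ∈ T, ∀ b, Code r b → Code r' b → r = r') : T.ncard ≤ Fintype.card β := by
  classical
  rcases T.eq_empty_or_nonempty with rfl | ⟨r₀, hr₀⟩
  · simp
  have hβ : Nonempty β := ⟨(h1 r₀ hr₀).choose⟩
  have h1' : ∀ r, ∃ b, r ∈ T → Code r b := fun r => by
    by_cases h : r ∈ T
    · obtain ⟨b, hb⟩ := h1 r h
      exact ⟨b, fun _ => hb⟩
    · exact ⟨hβ.some, fun h' => absurd h' h⟩
  choose f hf using h1'
  rw [← Nat.card_eq_fintype_card, ← Set.ncard_univ]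
  refine Set.ncard_le_ncard_of_injOn f (fun _ _ => Set.mem_univ _) ?_ Set.finite_univ
  intro r hr r' hr' h
  exact h2 r hr r' hr' (f r) (hf r hr) (h ▸ hf r' hr')

/-- `r` and `r'` agree off the letters at depths `t₀, …, t₀ + w - 1` on one side of `o`. -/
def AgreeOffWindow (o : ZMod n) (σ : Bool) (t₀ w : ℕ) (r r' : ZMod n → Letter k) : Prop :=
  ∀ y, (∀ t, t₀ ≤ t → t < t₀ + w → y ≠ outPos o σ t) → r y = r' y

/-- The exponent loses 2 because the two end letters of the window are given up to fit its
neighbours. -/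
lemma pow_le_ncard_agreeOffWindow [NeZero n] (hk : 2 ≤ k) {r : ZMod n → Letter k}
    (hr : r ∈ cycRed k n) (o : ZMod n) (σ : Bool) {t₀ w : ℕ} (hw : 2 ≤ w) (hwn : w < n) :
    (2 * k - 1) ^ (w - 2) ≤ {r' ∈ cycRed k n | AgreeOffWindow o σ t₀ w r r'}.ncard := by
  classical
  -- The first letter of the window in the order of `r`; on the negative side this is the deepest
  -- one.
  set x : ZMod n := if σ then o + t₀ else o - ((t₀ + w : ℕ) : ZMod n) with hx
  obtain ⟨S, hS1, hS2⟩ := exists_words hk {linv (r (x - 1))} {linv (r (x + (w : ZMod n)))}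
    (by simp) (by simp) hw
  have hpos : ∀ s < w, ∃ t, t₀ ≤ t ∧ t < t₀ + w ∧ x + (s : ZMod n) = outPos o σ t := by
    intro s hs
    cases σ
    · refine ⟨t₀ + (w - 1 - s), by omega, by omega, ?_⟩
      have e : ((t₀ + (w - 1 - s) : ℕ) : ZMod n) + (s : ZMod n) =
          ((t₀ + w : ℕ) : ZMod n) - 1 := by
        rw [← Nat.cast_add, show t₀ + (w - 1 - s) + s = t₀ + w - 1 by omega,
          Nat.cast_sub (by omega), Nat.cast_one]
      simp only [hx, outPos, Bool.false_eq_true, if_false]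
      linear_combination e
    · refine ⟨t₀ + s, by omega, by omega, ?_⟩
      simp [hx, outPos, add_assoc]
  have himg : (S.image (splice r x) : Set (ZMod n → Letter k)) ⊆
      {r' ∈ cycRed k n | AgreeOffWindow o σ t₀ w r r'} := by
    intro r' hr'
    simp only [Finset.coe_image, Set.mem_image, Finset.mem_coe] at hr'
    obtain ⟨v, hv, rfl⟩ := hr'
    obtain ⟨h1, h2, h3, h4⟩ := hS2 v hv
    refine ⟨splice_mem_cycRed hr (by omega) (by rintro rfl; simp at h1; omega) h2
      (by simpa using h3) (by simpa [h1] using h4), fun y hy => (splice_of_le ?_).symm⟩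
    by_contra hlt
    obtain ⟨t, ht1, ht2, ht3⟩ := hpos (y - x).val (by omega)
    exact hy t ht1 ht2 (by rw [← ht3]; simp)
  calc (2 * k - 1) ^ (w - 2) ≤ S.card := hS1
    _ = (S.image (splice r x)).card := by
      refine (Finset.card_image_of_injOn fun v hv v' hv' h => ?_).symm
      have h1 := (hS2 v hv).1
      have h2 := (hS2 v' hv').1
      exact splice_injective (by omega) (by omega) h
    _ = (S.image (splice r x) : Set (ZMod n → Letter k)).ncard := (Set.ncard_coe_finset _).symm
    _ ≤ _ := Set.ncard_le_ncard himg (Set.toFinite _)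

/-! ### Counting words with stray reads -/

/-- The path that starts with `d` and follows the boundary at each step, in the direction
prescribed by `c`. -/
def walk (rev : Side N n → Side N n) (d : Side N n) (c : ℕ → Bool) : ℕ → Side N n
  | 0 => d
  | j + 1 => if c j then next (walk rev d c j) else rev (prev (rev (walk rev d c j)))

lemma walk_congr (rev : Side N n → Side N n) (d : Side N n) {c c' : ℕ → Bool} :
    ∀ j, (∀ i < j, c i = c' i) → walk rev d c j = walk rev d c' j
  | 0, _ => rfl
  | j + 1, h => by
    simp only [walk]
    rw [walk_congr rev d j fun i hi => h i (by omega), h j (by omega)]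

section Stray

variable (C δ ε : ℝ) (gap : ℕ → ℕ) (L : ℕ) (R : BeadRule k N n)

/-- The words for which a given window of one bead can be read off that bead. -/
def strayEvent (o : ZMod n) (M i t₀ w : ℕ) (σ : Bool) : Set (ZMod n → Letter k) :=
  {r | r ∈ cycRed k n ∧ ∃ p, ∃ Y : Fatgraph (Side N n), IsBeadDecomposition C δ ε gap r o M p ∧
    IsBeadedSpine L (lipLength C n) R r o M p Y ∧ i < M ∧ p i + lipLength C n ≤ t₀ ∧
    t₀ + w ≤ p (i + 1) ∧ StrayRead r o M p Y σ i t₀ w}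

variable {C δ ε gap L R}

/-- This is where the locality of the rule enters: the gluing off bead `i` does not see the letters
of bead `i`. -/
lemma rev_eq_of_agree {l : ℕ} {r r' : ZMod n → Letter k} {o : ZMod n} {M i : ℕ} {p p' : ℕ → ℕ}
    {Y Y' : Fatgraph (Side N n)} (hY : IsBeadedSpine L l R r o M p Y)
    (hY' : IsBeadedSpine L l R r' o M p' Y') (hp : ∀ j ≤ M, p j = p' j)
    (hr : ∀ x, beadIndex o M p x ≠ i → r x = r' x) {d : Side N n}
    (hdi : beadIndex o M p d.2.2 ≠ i) : Y.rev d = Y'.rev d := by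
  by_cases h : IsLip l o M p d.2.2
  · obtain ⟨s, j, x⟩ := d
    rw [hY.rev_lip s j x h, hY'.rev_lip s j x ((isLip_congr hp x).1 h)]
  · rw [hY.rev_bead d h, hY'.rev_bead d (fun h' => h ((isLip_congr hp _).2 h')),
      ← beadIndex_congr hp]
    congr 1
    funext x
    unfold beadWord
    rw [← beadIndex_congr hp]
    split_ifs with hx
    · rw [hr x (by rw [hx]; exact hdi)]
    · rfl

/-- Resample the window. Given the letters off it, a stray path is encoded by its first edge and one
bit per step, and its label is the content of the window. -/
lemma ncard_strayEvent_mul_le [NeZero n] (hk : 2 ≤ k) (o : ZMod n) (M i t₀ : ℕ) {w : ℕ}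
    (hw : 2 ≤ w) (σ : Bool) :
    (strayEvent C δ ε gap L R o M i t₀ w σ).ncard * (2 * k - 1) ^ (w - 2) ≤
      (cycRed k n).ncard * (2 * (N * n) * 2 ^ w) := by
  refine ncard_mul_le_ncard_mul _ _ (AgreeOffWindow o σ t₀ w) ?_ ?_
  · rintro r ⟨hr, p, Y, hd, hY, hi, h1, h2, h3⟩
    have := hd.two_mul_add_le (i := i + 1) hi
    exact pow_le_ncard_agreeOffWindow hk hr o σ hw (by omega)
  · intro r' _
    rcases Set.eq_empty_or_nonempty
      {r ∈ strayEvent C δ ε gap L R o M i t₀ w σ | AgreeOffWindow o σ t₀ w r r'} with h | h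
    · rw [h]; simp
    obtain ⟨r₀, ⟨hr₀, p₀, Y₀, hd₀, hY₀, hi, h1₀, h2₀, -⟩, ha₀⟩ := h
    have hcard : Fintype.card (Side N n × (Fin w → Bool)) = 2 * (N * n) * 2 ^ w := by
      simp [ZMod.card]
    rw [← hcard]
    let extend : (Fin w → Bool) → ℕ → Bool := fun c j => if h : j < w then c ⟨j, h⟩ else false
    -- Decoding uses the graph and labels of the fixed word `r₀` only. Off bead `i` they coincide
    -- with those of every other word in the fibre, and stray paths stay off bead `i`.
    refine ncard_le_card_of_code (fun r b => ∀ j < w,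
      label r₀ (walk Y₀.rev b.1 (extend b.2) j) = outward r o σ (t₀ + j)) ?_ ?_
    · rintro r ⟨⟨hr, p, Y, hd, hY, -, h1, h2, g, hg1, hg2, hg3⟩, ha⟩
      have hbound := hd.two_mul_add_le (i := i + 1) hi
      have hwin : ∀ x, beadIndex o M p x ≠ i → r x = r₀ x := by
        intro x hx
        have hx' : ∀ t, t₀ ≤ t → t < t₀ + w → x ≠ outPos o σ t := by
          rintro t ht1 ht2 rfl
          refine hx ((hd.beadIndex_eq hi).2 ?_)
          rw [depth_outPos o σ (by omega)]
          omega
        rw [ha x hx', ha₀ x hx']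
      have hp : ∀ j ≤ M, p j = p₀ j := by
        refine hd.eq_of_agree hd₀ hi.le (a := t₀) (b := t₀ + w) h1 (fun _ => h2) h1₀
          (fun _ => h2₀) fun x hx => ?_
        have hx' : ∀ t, t₀ ≤ t → t < t₀ + w → x ≠ outPos o σ t := by
          rintro t ht1 ht2 rfl
          rw [depth_outPos o σ (by omega)] at hx
          omega
        rw [ha x hx', ha₀ x hx']
      have hrev : ∀ {d : Side N n}, beadIndex o M p d.2.2 ≠ i → Y.rev d = Y₀.rev d :=
        fun hdi => rev_eq_of_agree hY hY₀ hp hwin hdi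
      let c : ℕ → Bool := fun j => decide (g (j + 1) = next (g j))
      have hwalk : ∀ j < w, walk Y₀.rev (g 0) c j = g j := by
        intro j
        induction j with
        | zero => intro _; rfl
        | succ j ih =>
          intro hj
          rw [walk, ih (by omega)]
          by_cases hc : g (j + 1) = next (g j)
          · simp [c, hc]
          · rcases path_step hY.bdry_eq hY.label_rev hY.trivalent (hg1 j hj) (by
                rw [hg3 _ hj, hg3 j (by omega), ← add_assoc]
                exact outward_succ_ne hr o σ _) with h | h
            · exact absurd h hc
            · have h' := congrArg prev h
              rw [prev_next] at h'
              simp only [c, hc, decide_false, Bool.false_eq_true, if_false]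
              rw [← hrev (hg2 j (by omega)), ← h', ← hrev, Y.rev_rev]
              rw [hY.beadIndex_rev]
              exact hg2 _ hj
      refine ⟨(g 0, fun j => c j), fun j hj => ?_⟩
      have hext : walk Y₀.rev (g 0) (extend fun j => c j) j = g j := by
        rw [← hwalk j hj]
        exact walk_congr _ _ _ fun a haj => by simp [extend, show a < w by omega]
      simp only [hext]
      rw [← hg3 j hj]
      unfold label
      rw [hwin _ (hg2 j hj)]
    · rintro r ⟨-, ha⟩ r₁ ⟨-, ha₁⟩ b hb hb₁
      funext y
      by_cases hy : ∀ t, t₀ ≤ t → t < t₀ + w → y ≠ outPos o σ t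
      · rw [ha y hy, ha₁ y hy]
      · push Not at hy
        obtain ⟨t, ht1, ht2, rfl⟩ := hy
        rw [← outward_eq_iff, show t = t₀ + (t - t₀) by omega, ← hb _ (by omega),
          ← hb₁ _ (by omega)]

end Stray

/-! ### Resampling a lip -/

/-- The word `r` with the two sides of the lip at depth `q` replaced by `v`. -/
def resample (r : ZMod n → Letter k) (o : ZMod n) (q : ℕ) (v : List (Letter k)) :
    ZMod n → Letter k :=
  splice (splice r (o + q) v) (o - ((q + v.length : ℕ) : ZMod n)) (v.reverse.map linv)

lemma splice_outPos_of_notMem [NeZero n] (r : ZMod n → Letter k) {o : ZMod n} {q : ℕ}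
    {v : List (Letter k)} (hv : 2 * (q + v.length) ≤ n) {y : ZMod n}
    (hy : depth o y < q ∨ q + v.length ≤ depth o y) : splice r (o + q) v y = r y := by
  refine splice_of_le ?_
  by_contra hlt
  have h : y = outPos o true (q + (y - (o + q)).val) := by
    simp [outPos]
    ring
  rw [h, depth_outPos o true (by omega)] at hy
  omega

lemma splice_neg_of_notMem [NeZero n] (r : ZMod n → Letter k) {o : ZMod n} {q : ℕ}
    {v : List (Letter k)} {y : ZMod n}
    (hy : ∀ t, q ≤ t → t < q + v.length → y ≠ outPos o false t) :
    splice r (o - ((q + v.length : ℕ) : ZMod n)) v y = r y := by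
  refine splice_of_le ?_
  by_contra hlt
  push Not at hlt
  set s := (y - (o - ((q + v.length : ℕ) : ZMod n))).val with hs
  refine hy (q + v.length - 1 - s) (by omega) (by omega) ?_
  have h : y = o - ((q + v.length : ℕ) : ZMod n) + (s : ZMod n) := by
    rw [hs]; simp
  have e : ((q + v.length - 1 - s : ℕ) : ZMod n) + (s : ZMod n) =
      ((q + v.length : ℕ) : ZMod n) - 1 := by
    rw [← Nat.cast_add, show q + v.length - 1 - s + s = q + v.length - 1 by omega,
      Nat.cast_sub (by omega), Nat.cast_one]
  simp only [outPos, Bool.false_eq_true, if_false]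
  rw [h]
  linear_combination e

lemma resample_of_notMem [NeZero n] (r : ZMod n → Letter k) {o : ZMod n} {q : ℕ}
    {v : List (Letter k)} (hv : 2 * (q + v.length) ≤ n) {y : ZMod n}
    (hy : depth o y < q ∨ q + v.length ≤ depth o y) : resample r o q v y = r y := by
  have hlen : (v.reverse.map linv).length = v.length := by simp
  unfold resample
  rw [← hlen, splice_neg_of_notMem, splice_outPos_of_notMem _ hv hy]
  rintro t ht1 ht2 rfl
  rw [hlen] at ht2
  rw [depth_outPos o false (by omega)] at hy
  omega

lemma outward_resample [NeZero n] (r : ZMod n → Letter k) {o : ZMod n} {q : ℕ}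
    {v : List (Letter k)} (hv : 2 * (q + v.length) < n) (σ : Bool) {t : ℕ} (ht : t < v.length) :
    outward (resample r o q v) o σ (q + t) = v[t] := by
  have hlen : (v.reverse.map linv).length = v.length := by simp
  cases σ
  · have hpos : outPos o false (q + t) =
        o - ((q + v.length : ℕ) : ZMod n) + ((v.length - 1 - t : ℕ) : ZMod n) := by
      have e : ((v.length - 1 - t : ℕ) : ZMod n) + ((q + t : ℕ) : ZMod n) =
          ((q + v.length : ℕ) : ZMod n) - 1 := by
        rw [← Nat.cast_add, show v.length - 1 - t + (q + t) = q + v.length - 1 by omega,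
          Nat.cast_sub (by omega), Nat.cast_one]
      simp only [outPos, Bool.false_eq_true, if_false]
      linear_combination -e
    simp only [outward, Bool.false_eq_true, if_false]
    rw [hpos, resample, splice_add (by omega) (by omega), List.getElem_map, linv_linv,
      List.getElem_reverse]
    congr 1
    omega
  · have hpos : outPos o true (q + t) = o + (q : ZMod n) + (t : ZMod n) := by
      simp [outPos, add_assoc]
    simp only [outward, if_true]
    rw [resample, ← hlen, splice_neg_of_notMem, hpos,
      splice_add (by omega) ht]
    intro t' ht1 ht2
    exact outPos_true_ne_false o (by omega) (by omega) (by omega)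

lemma redChain_reverse {v : List (Letter k)} (h : RedChain v) :
    RedChain (v.reverse.map linv) := by
  unfold RedChain at h ⊢
  rw [List.isChain_map, List.isChain_reverse]
  refine h.imp fun a b hab => ?_
  rw [linv_linv]
  exact hab.symm

/-- The negative copy is inverted and reversed, so both copies of `v` face the same end conditions,
once for each side. -/
lemma resample_mem_cycRed [NeZero n] {r : ZMod n → Letter k} (hr : r ∈ cycRed k n) {o : ZMod n}
    {q : ℕ} {v : List (Letter k)} (hq : 0 < q) (hne : v ≠ []) (hv : 2 * (q + v.length) < n)
    (hc : RedChain v) (hhead : ∀ a ∈ v.head?, ∀ σ, a ≠ linv (outward r o σ (q - 1)))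
    (hlast : ∀ b ∈ v.getLast?, ∀ σ, b ≠ linv (outward r o σ (q + v.length))) :
    resample r o q v ∈ cycRed k n := by
  have hlen : (v.reverse.map linv).length = v.length := by simp
  have e1 : o + (q : ZMod n) - 1 = outPos o true (q - 1) := by
    simp only [outPos, if_true]
    rw [Nat.cast_sub hq, Nat.cast_one]; ring
  have e2 : o + (q : ZMod n) + (v.length : ZMod n) = outPos o true (q + v.length) := by
    simp [outPos, add_assoc]
  have e3 : o - ((q + v.length : ℕ) : ZMod n) - 1 = outPos o false (q + v.length) := by
    simp [outPos]; ring
  have e4 : o - ((q + v.length : ℕ) : ZMod n) + (v.length : ZMod n) = outPos o false (q - 1) := by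
    simp only [outPos, Bool.false_eq_true, if_false]
    rw [Nat.cast_sub hq]; push_cast; ring
  have h1 : splice r (o + q) v ∈ cycRed k n := by
    refine splice_mem_cycRed hr (by omega) hne hc ?_ ?_
    · intro a ha
      rw [e1]
      exact hhead a ha true
    · intro b hb
      rw [e2]
      exact hlast b hb true
  refine splice_mem_cycRed h1 (by omega) (by simpa using hne) (redChain_reverse hc) ?_ ?_
  · intro a ha
    rw [e3, splice_outPos_of_notMem r hv.le
      (by rw [depth_outPos o false (by omega)]; omega)]
    rw [List.head?_map, List.head?_reverse, Option.mem_def, Option.map_eq_some_iff] at ha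
    obtain ⟨b, hb, rfl⟩ := ha
    have := hlast b hb false
    simp only [outward, Bool.false_eq_true, if_false, linv_linv] at this
    exact fun h => this (linv_inj.1 h)
  · intro a ha
    rw [hlen, e4, splice_outPos_of_notMem r hv.le
      (by rw [depth_outPos o false (by omega)]; omega)]
    rw [List.getLast?_map, List.getLast?_reverse, Option.mem_def, Option.map_eq_some_iff] at ha
    obtain ⟨b, hb, rfl⟩ := ha
    have := hhead b hb false
    simp only [outward, Bool.false_eq_true, if_false, linv_linv] at this
    exact fun h => this (linv_inj.1 h)

/-! ### Counting words with consecutive bad lips -/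

section Lips

variable {C δ ε : ℝ} {gap : ℕ → ℕ}

/-- Taking `i = M` makes the conditions on `b` in `eq_of_agree` vacuous. -/
lemma IsBeadDecomposition.unique [NeZero n] {r : ZMod n → Letter k} {o : ZMod n} {M : ℕ}
    {p p' : ℕ → ℕ} (hd : IsBeadDecomposition C δ ε gap r o M p)
    (hd' : IsBeadDecomposition C δ ε gap r o M p') : ∀ j ≤ M, p j = p' j :=
  hd.eq_of_agree hd' le_rfl (a := p M + p' M + lipLength C n) (b := 0) (by omega)
    (fun h => absurd h (lt_irrefl M)) (by omega) (fun h => absurd h (lt_irrefl M))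
    fun _ _ => rfl

/-- The depths of the lips only depend on the coincidences between the two sides. -/
lemma IsBeadDecomposition.of_coincidence {r r' : ZMod n → Letter k} {o : ZMod n} {M : ℕ}
    {p : ℕ → ℕ} (hd : IsBeadDecomposition C δ ε gap r o M p)
    (h : ∀ t, 2 * t < n → (outward r' o false t = outward r' o true t ↔
      outward r o false t = outward r o true t)) :
    IsBeadDecomposition C δ ε gap r' o M p := by
  have hm : ∀ t, 2 * (t + lipLength C n) ≤ n →
      (MatchAt r' o (lipLength C n) t ↔ MatchAt r o (lipLength C n) t) := by
    intro t ht
    rw [matchAt_iff, matchAt_iff]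
    exact forall₂_congr fun a ha => h _ (by omega)
  refine { hd with first := fun i hi => ?_ }
  have hb := hd.two_mul_add_le (i := i + 1) hi
  refine ⟨⟨(hd.first i hi).1.1, (hm _ hb).2 (hd.first i hi).1.2⟩, ?_⟩
  rintro t ⟨ht1, ht2⟩
  by_contra hlt
  push Not at hlt
  exact absurd ((hd.first i hi).2 ⟨ht1, (hm t (by omega)).1 ht2⟩) (by omega)

variable (C δ ε gap)

/-- The words for which `m` consecutive lips, from the `i₀`-th on, are bad. -/
def badLipEvent (k : ℕ) (o : ZMod n) (σ : Bool) (M w i₀ m : ℕ) : Set (ZMod n → Letter k) :=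
  {r | r ∈ cycRed k n ∧ ∃ p, IsBeadDecomposition C δ ε gap r o M p ∧ 0 < p 1 ∧
    (∀ i, 1 ≤ i → i < M → p i + 4 * w ≤ p (i + 1)) ∧
    ∀ j < m, BadLip r o σ (lipLength C n) w (p (i₀ + j))}

/-- `r` and `r'` have the same lips, and agree off the `i`-th lip. -/
def AgreeOffLip (o : ZMod n) (M i : ℕ) (r r' : ZMod n → Letter k) : Prop :=
  ∃ p, IsBeadDecomposition C δ ε gap r o M p ∧ IsBeadDecomposition C δ ε gap r' o M p ∧
    ∀ x, (depth o x < p i ∨ p i + lipLength C n ≤ depth o x) → r x = r' x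

variable {C δ ε gap}

/-- A word with a bad lip is determined by the letters off this lip and the shift. -/
lemma outward_eq_of_shift {r r' : ZMod n → Letter k} {o : ZMod n} {σ : Bool} {l q q' b : ℕ}
    (hne : q' ≠ q) (hb : q' + l ≤ b)
    (hag : ∀ t < b, (t < q ∨ q + l ≤ t) → outward r o σ t = outward r' o σ t)
    (h : ∀ t < l, outward r o σ (q' + t) = outward r o σ (q + t))
    (h' : ∀ t < l, outward r' o σ (q' + t) = outward r' o σ (q + t)) :
    ∀ t < l, outward r o σ (q + t) = outward r' o σ (q + t) := by
  rcases lt_or_gt_of_ne hne with hlt | hlt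
  · intro t
    induction t using Nat.strong_induction_on with
    | _ t ih =>
      intro ht
      rw [← h t ht, ← h' t ht]
      by_cases hc : q' + t < q
      · exact hag _ (by omega) (Or.inl hc)
      · have := ih (q' + t - q) (by omega) (by omega)
        rwa [show q + (q' + t - q) = q' + t by omega] at this
  · have key : ∀ s t, t + s = l → 0 < s → outward r o σ (q + t) = outward r' o σ (q + t) := by
      intro s
      induction s using Nat.strong_induction_on with
      | _ s ih =>
        intro t hts hs
        rw [← h t (by omega), ← h' t (by omega)]
        by_cases hc : q + l ≤ q' + t
        · exact hag _ (by omega) (Or.inr hc)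
        · have := ih (l - (q' + t - q)) (by omega) (q' + t - q) (by omega) (by omega)
          rwa [show q + (q' + t - q) = q' + t by omega] at this
    intro t ht
    exact key (l - t) t (by omega) (by omega)

/-- Both sides of the last bad lip are replaced by the same word, so coincidences between the sides,
and with them all lips, survive. The earlier lips stay bad: what witnesses this lies within `3 * w`
beyond their beginning, while the beads have length at least `4 * w`. -/
lemma pow_le_ncard_agreeOffLip [NeZero n] (hk : 2 ≤ k) (hl : 2 ≤ lipLength C n) {w : ℕ}
    (hw : lipLength C n ≤ w) {o : ZMod n} {σ : Bool} {M i₀ m : ℕ} (hi₀ : 1 ≤ i₀)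
    (hM : i₀ + m < M) {r : ZMod n → Letter k}
    (hr : r ∈ badLipEvent C δ ε gap k o σ M w i₀ (m + 1)) :
    (2 * k - 1) ^ (lipLength C n - 2) ≤ {r' ∈ badLipEvent C δ ε gap k o σ M w i₀ m |
      AgreeOffLip C δ ε gap o M (i₀ + m) r r'}.ncard := by
  classical
  obtain ⟨hr, p, hd, hp1, hlong, hbad⟩ := hr
  set q := p (i₀ + m) with hq
  have hq0 : 0 < q := hp1.trans_le (hd.mono (by omega) (by omega))
  have hb1 := hlong (i₀ + m) (by omega) hM
  have hb2 := hd.two_mul_add_le (i := i₀ + m + 1) hM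
  rw [← hq] at hb1
  have hbound : 2 * (q + lipLength C n) < n := by omega
  obtain ⟨S, hS1, hS2⟩ := exists_words hk
    {linv (outward r o true (q - 1)), linv (outward r o false (q - 1))}
    {linv (outward r o true (q + lipLength C n)), linv (outward r o false (q + lipLength C n))}
    Finset.card_le_two Finset.card_le_two hl
  have himg : (S.image (resample r o q) : Set (ZMod n → Letter k)) ⊆
      {r' ∈ badLipEvent C δ ε gap k o σ M w i₀ m |
        AgreeOffLip C δ ε gap o M (i₀ + m) r r'} := by
    intro r' hr'
    simp only [Finset.coe_image, Set.mem_image, Finset.mem_coe] at hr'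
    obtain ⟨v, hv, rfl⟩ := hr'
    obtain ⟨h1, h2, h3, h4⟩ := hS2 v hv
    have hoff : ∀ x, (depth o x < q ∨ q + lipLength C n ≤ depth o x) →
        resample r o q v x = r x := fun x hx =>
      resample_of_notMem r (by omega) (by rwa [h1])
    have hout : ∀ t, 2 * t < n → (t < q ∨ q + lipLength C n ≤ t) → ∀ σ,
        outward (resample r o q v) o σ t = outward r o σ t := by
      intro t ht1 ht2 σ
      rw [outward_eq_iff]
      exact hoff _ (by rwa [depth_outPos o σ ht1])
    have hd' : IsBeadDecomposition C δ ε gap (resample r o q v) o M p := by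
      refine hd.of_coincidence fun t ht => ?_
      by_cases hlip : t < q ∨ q + lipLength C n ≤ t
      · rw [hout t ht hlip, hout t ht hlip]
      · push Not at hlip
        have e : t = q + (t - q) := by omega
        have hm := matchAt_iff.1 (hd.matchAt (i := i₀ + m) (by omega) (by omega)) (t - q)
          (by omega)
        rw [← hq, ← e] at hm
        refine iff_of_true ?_ hm
        rw [e, outward_resample r (by omega) false (by omega),
          outward_resample r (by omega) true (by omega)]
    refine ⟨⟨?_, p, hd', hp1, hlong, fun j hj => ?_⟩, p, hd, hd', fun x hx => (hoff x hx).symm⟩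
    · refine resample_mem_cycRed hr hq0 (by rintro rfl; simp at h1; omega) (by omega) h2 ?_ ?_
      · intro a ha τ
        have := h3 a ha
        simp only [Finset.mem_insert, Finset.mem_singleton, not_or] at this
        cases τ
        · exact this.2
        · exact this.1
      · intro a ha τ
        have := h4 a ha
        simp only [Finset.mem_insert, Finset.mem_singleton, not_or] at this
        rw [h1]
        cases τ
        · exact this.2
        · exact this.1
    · obtain ⟨q', hq1, hq2, hq3, hq4⟩ := hbad j (by omega)
      have hb3 := hlong (i₀ + j) (by omega) (by omega)
      have hb4 := hd.mono (show i₀ + j + 1 ≤ i₀ + m by omega) (by omega)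
      rw [← hq] at hb4
      refine ⟨q', hq1, hq2, hq3, fun t ht => ?_⟩
      rw [hout _ (by omega) (by omega), hout _ (by omega) (by omega)]
      exact hq4 t ht
  calc (2 * k - 1) ^ (lipLength C n - 2) ≤ S.card := hS1
    _ = (S.image (resample r o q)).card := by
      refine (Finset.card_image_of_injOn fun v hv v' hv' h => ?_).symm
      have h1 := (hS2 v hv).1
      have h2 := (hS2 v' hv').1
      refine List.ext_getElem (by omega) fun t ht1 ht2 => ?_
      rw [← outward_resample r (o := o) (q := q) (by omega) true ht1, h,
        outward_resample r (by omega) true ht2]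
    _ = (S.image (resample r o q) : Set (ZMod n → Letter k)).ncard :=
      (Set.ncard_coe_finset _).symm
    _ ≤ _ := Set.ncard_le_ncard himg (Set.toFinite _)

/-- The word `r'` determines the place of the lip, by uniqueness. The shift, offset by `2 * w` to be
a natural number, then determines the lip word of `r`. -/
lemma ncard_badLipEvent_succ_mul_le [NeZero n] (hk : 2 ≤ k) (hl : 2 ≤ lipLength C n) {w : ℕ}
    (hw : lipLength C n ≤ w) (o : ZMod n) (σ : Bool) {M i₀ m : ℕ} (hi₀ : 1 ≤ i₀)
    (hM : i₀ + m < M) :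
    (badLipEvent C δ ε gap k o σ M w i₀ (m + 1)).ncard * (2 * k - 1) ^ (lipLength C n - 2) ≤
      (badLipEvent C δ ε gap k o σ M w i₀ m).ncard * (4 * w + 1) := by
  refine ncard_mul_le_ncard_mul _ _ (AgreeOffLip C δ ε gap o M (i₀ + m))
    (fun r hr => pow_le_ncard_agreeOffLip hk hl hw hi₀ hM hr) fun r' _ => ?_
  rcases Set.eq_empty_or_nonempty {r ∈ badLipEvent C δ ε gap k o σ M w i₀ (m + 1) |
    AgreeOffLip C δ ε gap o M (i₀ + m) r r'} with h | h
  · rw [h]; simp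
  obtain ⟨r₀, -, p, -, hd₀, -⟩ := h
  conv_rhs => rw [← Fintype.card_fin (4 * w + 1)]
  have hall : ∀ r, r ∈ badLipEvent C δ ε gap k o σ M w i₀ (m + 1) ∧
      AgreeOffLip C δ ε gap o M (i₀ + m) r r' →
      MatchAt r o (lipLength C n) (p (i₀ + m)) ∧
      2 * (p (i₀ + m) + 4 * w + lipLength C n) ≤ n ∧
      BadLip r o σ (lipLength C n) w (p (i₀ + m)) ∧
      ∀ x, (depth o x < p (i₀ + m) ∨ p (i₀ + m) + lipLength C n ≤ depth o x) → r x = r' x := by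
    rintro r ⟨⟨hr, p₁, hd₁, -, hlong, hbad⟩, p₂, hd₂, hd₂', hag⟩
    have h12 := hd₁.unique hd₂
    have h20 := hd₂'.unique hd₀
    have h10 : p₁ (i₀ + m) = p (i₀ + m) := (h12 _ (by omega)).trans (h20 _ (by omega))
    rw [← h10]
    refine ⟨hd₁.matchAt (by omega) (by omega), ?_, hbad m (by omega), ?_⟩
    · have h1 := hlong (i₀ + m) (by omega) hM
      have h2 := hd₁.two_mul_add_le (i := i₀ + m + 1) hM
      omega
    · rwa [h12 _ (by omega)]
  generalize p (i₀ + m) = q at hall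
  refine ncard_le_card_of_code (fun r (b : Fin (4 * w + 1)) => ∃ q', q' + 2 * w = q + b ∧
    q' ≠ q ∧ ∀ t < lipLength C n, outward r o σ (q' + t) = outward r o σ (q + t)) ?_ ?_
  · intro r hr
    obtain ⟨-, -, ⟨q', h1, h2, h3, h4⟩, -⟩ := hall r hr
    exact ⟨⟨q' + 2 * w - q, by omega⟩, q', by simp only; omega, h1, h4⟩
  · rintro r hr r₁ hr₁ b ⟨q', h1, h2, h3⟩ ⟨q'', h1', -, h3'⟩
    obtain rfl : q' = q'' := by omega
    obtain ⟨hm, hn, -, hag⟩ := hall r hr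
    obtain ⟨hm₁, -, -, hag₁⟩ := hall r₁ hr₁
    have hb := b.2
    have hside : ∀ t < lipLength C n, outward r o σ (q + t) = outward r₁ o σ (q + t) := by
      refine outward_eq_of_shift (b := q' + lipLength C n) h2 le_rfl (fun t ht1 ht2 => ?_) h3 h3'
      rw [outward_eq_iff]
      have ht : 2 * t < n := by omega
      rw [hag _ (by rwa [depth_outPos o σ ht]), hag₁ _ (by rwa [depth_outPos o σ ht])]
    -- Badness controls the side `σ` only; the other side follows since the two sides match.
    have hsides : ∀ τ, ∀ t < lipLength C n, outward r o τ (q + t) = outward r₁ o τ (q + t) := by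
      intro τ t ht
      have e := matchAt_iff.1 hm t ht
      have e₁ := matchAt_iff.1 hm₁ t ht
      have := hside t ht
      cases σ <;> cases τ <;> simp_all
    funext x
    by_cases hx : depth o x < q ∨ q + lipLength C n ≤ depth o x
    · rw [hag x hx, hag₁ x hx]
    · push Not at hx
      obtain ⟨τ, hτ⟩ := exists_eq_outPos o x
      rw [hτ, ← outward_eq_iff, show depth o x = q + (depth o x - q) by omega]
      exact hsides τ _ (by omega)

lemma ncard_badLipEvent_mul_pow_le [NeZero n] (hk : 2 ≤ k) (hl : 2 ≤ lipLength C n) {w : ℕ}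
    (hw : lipLength C n ≤ w) (o : ZMod n) (σ : Bool) {M i₀ : ℕ} (hi₀ : 1 ≤ i₀) (m : ℕ)
    (hM : i₀ + m ≤ M) :
    (badLipEvent C δ ε gap k o σ M w i₀ m).ncard * ((2 * k - 1) ^ (lipLength C n - 2)) ^ m ≤
      (cycRed k n).ncard * (4 * w + 1) ^ m := by
  induction m with
  | zero =>
    simp only [pow_zero, mul_one]
    exact Set.ncard_le_ncard (fun r hr => hr.1) (Set.toFinite _)
  | succ m ih =>
    calc _ = (badLipEvent C δ ε gap k o σ M w i₀ (m + 1)).ncard *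
          (2 * k - 1) ^ (lipLength C n - 2) * ((2 * k - 1) ^ (lipLength C n - 2)) ^ m := by ring
      _ ≤ (badLipEvent C δ ε gap k o σ M w i₀ m).ncard * (4 * w + 1) *
          ((2 * k - 1) ^ (lipLength C n - 2)) ^ m :=
        Nat.mul_le_mul_right _ (ncard_badLipEvent_succ_mul_le hk hl hw o σ hi₀ (by omega))
      _ = (badLipEvent C δ ε gap k o σ M w i₀ m).ncard *
          ((2 * k - 1) ^ (lipLength C n - 2)) ^ m * (4 * w + 1) := by ring
      _ ≤ (cycRed k n).ncard * (4 * w + 1) ^ m * (4 * w + 1) :=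
        Nat.mul_le_mul_right _ (ih (by omega))
      _ = _ := by ring

end Lips

/-! ### Union bound -/

lemma cycRed_nonempty (hk : 2 ≤ k) : (cycRed k n).Nonempty := by
  refine ⟨fun _ => (⟨0, by omega⟩, true), fun x h => ?_⟩
  simp [linv] at h

lemma one_sub_le_prob [NeZero n] (hk : 2 ≤ k) {E F : Set (ZMod n → Letter k)} {b : ℝ}
    (hEF : ∀ r ∈ cycRed k n, r ∉ E → r ∈ F) (hF : (F.ncard : ℝ) ≤ b * (cycRed k n).ncard) :
    1 - b ≤ prob k n E := by
  have hpos : (0 : ℝ) < (cycRed k n).ncard := by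
    exact_mod_cast (Set.ncard_pos (Set.toFinite _)).2 (cycRed_nonempty hk)
  have hsub : cycRed k n ⊆ (cycRed k n ∩ E) ∪ F := by
    intro r hr
    by_cases h : r ∈ E
    · exact Or.inl ⟨hr, h⟩
    · exact Or.inr (hEF r hr h)
  have hcard : (cycRed k n).ncard ≤ (cycRed k n ∩ E).ncard + F.ncard :=
    (Set.ncard_le_ncard hsub (Set.toFinite _)).trans (Set.ncard_union_le _ _)
  have hcard' : ((cycRed k n).ncard : ℝ) ≤ (cycRed k n ∩ E).ncard + F.ncard := by
    exact_mod_cast hcard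
  unfold prob
  rw [le_div_iff₀ hpos]
  linarith

section Union

variable {C δ ε : ℝ} {gap : ℕ → ℕ} {L : ℕ} {R : BeadRule k N n}

/-- This bounds the number of beads by `n`, so that the union bound has polynomially many terms. -/
lemma IsBeadDecomposition.le_depth {r : ZMod n → Letter k} {o : ZMod n} {M : ℕ} {p : ℕ → ℕ}
    (hd : IsBeadDecomposition C δ ε gap r o M p) (hl : 0 < lipLength C n) (h1 : 0 < p 1) :
    M ≤ p M := by
  have : ∀ i, 1 ≤ i → i ≤ M → i ≤ p i := by
    intro i hi
    induction i, hi using Nat.le_induction with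
    | base => intro _; exact h1
    | succ i hi ih =>
      intro h
      have := hd.fits i hi h
      have := ih (by omega)
      omega
  exact this M hd.pos le_rfl

variable (C δ ε gap L R)

/-- The words for which some window of a bead can be read off this bead, or there are `K`
consecutive bad lips. -/
def exceptional (w K : ℕ) : Set (ZMod n → Letter k) :=
  (⋃ a : ZMod n × Fin (n + 1) × Fin (n + 1) × Fin (n + 1) × Bool,
    strayEvent C δ ε gap L R a.1 a.2.1 a.2.2.1 a.2.2.2.1 w a.2.2.2.2) ∪
  ⋃ a : {a : ZMod n × Fin (n + 1) × Fin (n + 1) × Bool // 1 ≤ (a.2.2.1 : ℕ) ∧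
      (a.2.2.1 : ℕ) + K ≤ a.2.1},
    badLipEvent C δ ε gap k a.1.1 a.1.2.2.2 a.1.2.1 w a.1.2.2.1 K

lemma ncard_exceptional_le [NeZero n] (hk : 2 ≤ k) {w : ℕ} (K : ℕ) (hl : 2 ≤ lipLength C n)
    (hw : lipLength C n ≤ w) : ((exceptional C δ ε gap L R w K).ncard : ℝ) ≤
      (2 * n * (n + 1) ^ 3 * (2 * (N * n) * 2 ^ w / (2 * k - 1) ^ (w - 2)) +
        2 * n * (n + 1) ^ 2 * ((4 * w + 1) / (2 * k - 1) ^ (lipLength C n - 2)) ^ K) *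
          (cycRed k n).ncard := by
  have hk1 : ((2 * k - 1 : ℕ) : ℝ) = 2 * k - 1 := by
    rw [Nat.cast_sub (by omega)]; push_cast; ring
  have hk0 : (0 : ℝ) < 2 * k - 1 := by
    have : (2 : ℝ) ≤ k := by exact_mod_cast hk
    linarith
  have h1 : ((⋃ a : ZMod n × Fin (n + 1) × Fin (n + 1) × Fin (n + 1) × Bool,
      strayEvent C δ ε gap L R a.1 a.2.1 a.2.2.1 a.2.2.2.1 w a.2.2.2.2).ncard : ℝ) ≤
      2 * n * (n + 1) ^ 3 * (2 * (N * n) * 2 ^ w / (2 * k - 1) ^ (w - 2)) *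
        (cycRed k n).ncard := by
    refine (Nat.cast_le.2 (Set.ncard_iUnion_le_of_fintype _)).trans ?_
    rw [Nat.cast_sum]
    refine (Finset.sum_le_card_nsmul _ _
      (2 * (N * n) * 2 ^ w / (2 * k - 1) ^ (w - 2) * (cycRed k n).ncard : ℝ) fun a _ => ?_).trans ?_
    · rw [div_mul_eq_mul_div, le_div_iff₀ (by positivity), ← hk1]
      have := ncard_strayEvent_mul_le (C := C) (δ := δ) (ε := ε) (gap := gap) (L := L) (R := R)
        hk a.1 a.2.1 a.2.2.1 a.2.2.2.1 (hl.trans hw) a.2.2.2.2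
      rw [mul_comm (2 * (N * n : ℝ) * 2 ^ w)]
      exact_mod_cast this
    · refine le_of_eq ?_
      simp [ZMod.card]
      ring
  have h2 : ((⋃ a : {a : ZMod n × Fin (n + 1) × Fin (n + 1) × Bool // 1 ≤ (a.2.2.1 : ℕ) ∧
      (a.2.2.1 : ℕ) + K ≤ a.2.1},
      badLipEvent C δ ε gap k a.1.1 a.1.2.2.2 a.1.2.1 w a.1.2.2.1 K).ncard : ℝ) ≤
      2 * n * (n + 1) ^ 2 * ((4 * w + 1) / (2 * k - 1) ^ (lipLength C n - 2)) ^ K *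
        (cycRed k n).ncard := by
    refine (Nat.cast_le.2 (Set.ncard_iUnion_le_of_fintype _)).trans ?_
    rw [Nat.cast_sum]
    refine (Finset.sum_le_card_nsmul _ _
      (((4 * w + 1) / (2 * k - 1) ^ (lipLength C n - 2)) ^ K * (cycRed k n).ncard : ℝ)
        fun a _ => ?_).trans ?_
    · rw [div_pow, div_mul_eq_mul_div, le_div_iff₀ (by positivity), ← hk1]
      have := ncard_badLipEvent_mul_pow_le (C := C) (δ := δ) (ε := ε) (gap := gap)
        hk hl hw a.1.1 a.1.2.2.2 a.2.1 K a.2.2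
      rw [mul_comm ((4 * w + 1 : ℝ) ^ K)]
      exact_mod_cast this
    · rw [nsmul_eq_mul, mul_assoc (2 * n * (n + 1) ^ 2 : ℝ)]
      refine mul_le_mul_of_nonneg_right ?_ (by positivity)
      have hc := Fintype.card_subtype_le (fun a : ZMod n × Fin (n + 1) × Fin (n + 1) × Bool =>
        1 ≤ (a.2.2.1 : ℕ) ∧ (a.2.2.1 : ℕ) + K ≤ a.2.1)
      have hc' : Fintype.card (ZMod n × Fin (n + 1) × Fin (n + 1) × Bool) =
          2 * n * (n + 1) ^ 2 := by
        simp [ZMod.card]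
        ring
      rw [hc'] at hc
      rw [Finset.card_univ]
      exact_mod_cast hc
  have h3 : ((exceptional C δ ε gap L R w K).ncard : ℝ) ≤ _ :=
    Nat.cast_le.2 (Set.ncard_union_le _ _)
  push_cast at h3
  linarith

variable {C δ ε gap L R}

/-- Off the exceptional set the conclusion of the theorem holds. -/
lemma inBoundary_of_notMem_exceptional [NeZero n] {w K D b : ℕ} {β : ℝ}
    (hl : 2 ≤ lipLength C n) (hw : lipLength C n ≤ w) (hε : |ε| ≤ 1 / 4)
    (hX : 16 * (w : ℝ) ≤ (n : ℝ) ^ (1 - δ)) (hD : (n : ℝ) ^ (1 - δ) ≤ D)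
    (hKb : (K + 4) * D ≤ b) (hb0 : 0 < b) (hb1 : 3 * (b : ℝ) ≤ β * n) (hb2 : 2 * b ≤ n)
    {r : ZMod n → Letter k} (hr : r ∈ cycRed k n) (hre : r ∉ exceptional C δ ε gap L R w K)
    {o : ZMod n} {M : ℕ} {p : ℕ → ℕ} (hd : IsBeadDecomposition C δ ε gap r o M p)
    {Y : Fatgraph (Side N n)} (hY : IsBeadedSpine L (lipLength C n) R r o M p Y) {m : ℕ}
    {γ : ℕ → Side N n} (hm : β * n ≤ m) (hγ : Y.IsPath m γ) (ha : Appears r m γ) :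
    Y.InBoundary m γ := by
  have hw2 : (2 : ℝ) ≤ w := by exact_mod_cast hl.trans hw
  set X : ℝ := (n : ℝ) ^ (1 - δ) with hXdef
  -- With relative error at most `1 / 4` the intermediate beads have length at least `X / 4 ≥ 4 *
  -- w`, and every step between lips is at most `X ≤ D`.
  have hεX : ε * X ≤ 1 / 4 * X :=
    mul_le_mul_of_nonneg_right ((le_abs_self ε).trans hε) (by linarith)
  have hp1 : 0 < p 1 := by
    have h := (abs_le.1 (hd.length_zero.trans hεX)).1
    have : (0 : ℝ) < p 1 := by linarith
    exact_mod_cast this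
  have hlong : ∀ i, 1 ≤ i → i < M → p i + 4 * w ≤ p (i + 1) := by
    intro i hi hiM
    have h := (abs_le.1 ((hd.length_mid i hi hiM).trans hεX)).1
    have : (p i : ℝ) + 4 * w ≤ p (i + 1) := by linarith
    exact_mod_cast this
  have hD' : ∀ i < M, p (i + 1) ≤ p i + D := by
    intro i hiM
    have : (p (i + 1) : ℝ) ≤ p i + D := by
      rcases Nat.eq_zero_or_pos i with rfl | hi
      · have h := (abs_le.1 (hd.length_zero.trans hεX)).2
        have h0 : (0 : ℝ) ≤ p 0 := Nat.cast_nonneg _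
        rw [zero_add]
        linarith
      · have h := (abs_le.1 ((hd.length_mid i hi hiM).trans hεX)).2
        linarith
    exact_mod_cast this
  have hDM : n ≤ 2 * (p M + D) := by
    have h := (abs_le.1 (hd.length_last.trans hεX)).2
    have : (n : ℝ) ≤ 2 * (p M + D) := by linarith
    exact_mod_cast this
  have hM : M ≤ p M := hd.le_depth (by omega) hp1
  have hMn := hd.two_mul_add_le le_rfl
  simp only [exceptional, Set.mem_union, Set.mem_iUnion, not_or, not_exists] at hre
  refine inBoundary_of_appears hr hd hY (by omega) hw hlong hD' hDM hKb hb0 ?_ ?_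
    (b := b) ?_ hb2 hγ ha
  · intro σ i t hi hiM ht1 ht2 hs
    have := hd.mono (show i + 1 ≤ M from hiM) le_rfl
    exact hre.1 (o, ⟨M, by omega⟩, ⟨i, by omega⟩, ⟨t, by omega⟩, σ)
      ⟨hr, p, Y, hd, hY, hiM, ht1, ht2, hs⟩
  · intro σ i hi hiM
    by_contra hcon
    push Not at hcon
    exact hre.2 ⟨(o, ⟨M, by omega⟩, ⟨i, by omega⟩, σ), hi, hiM⟩ ⟨hr, p, hd, hp1, hlong, hcon⟩
  · have : (3 * b : ℝ) ≤ m := hb1.trans hm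
    exact_mod_cast this

end Union

open Filter

/-! ### Asymptotic estimates -/

lemma eventually_mul_rpow_le {a b c : ℝ} (hab : a < b) (hc : 0 < c) (A : ℝ) :
    ∀ᶠ x : ℝ in atTop, A * x ^ a ≤ c * x ^ b := by
  have h := (tendsto_rpow_atTop (sub_pos.2 hab)).eventually_ge_atTop (A / c)
  filter_upwards [h, eventually_gt_atTop 0] with x hx hx0
  rw [Real.rpow_sub hx0, div_le_div_iff₀ hc (Real.rpow_pos_of_pos hx0 a)] at hx
  linarith

lemma eventually_log_le {η : ℝ} (hη : 0 < η) (C : ℝ) :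
    ∀ᶠ x : ℝ in atTop, C * Real.log x ≤ x ^ η := by
  have h := ((isLittleO_log_rpow_atTop hη).const_mul_left C).bound one_pos
  filter_upwards [h, eventually_gt_atTop 0] with x hx hx0
  rw [Real.norm_eq_abs, Real.norm_eq_abs, abs_of_pos (Real.rpow_pos_of_pos hx0 η), one_mul] at hx
  exact (le_abs_self _).trans hx

/-- Halving the exponent `θ` leaves room to absorb the polynomial factor. -/
lemma eventually_pow_mul_exp_le {θ a : ℝ} (hθ : 0 < θ) (ha : 0 < a) (A : ℝ) (d : ℕ) :
    ∀ᶠ x : ℝ in atTop, A * x ^ d * Real.exp (-(a * x ^ θ)) ≤ Real.exp (-x ^ (θ / 2)) := by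
  have ht : Tendsto (fun x : ℝ => x ^ (θ / 2)) atTop atTop := tendsto_rpow_atTop (by positivity)
  have h1 := ((isLittleO_rpow_exp_pos_mul_atTop (d / (θ / 2)) one_pos).const_mul_left A).bound
    one_pos
  filter_upwards [ht.eventually h1, ht.eventually_ge_atTop (2 / a), eventually_gt_atTop 0]
    with x h1 h2 hx
  rw [Real.norm_eq_abs, Real.norm_eq_abs, abs_of_pos (Real.exp_pos _), one_mul, one_mul,
    ← Real.rpow_mul hx.le, mul_div_cancel₀ _ (by positivity), Real.rpow_natCast] at h1
  have h3 : x ^ θ = x ^ (θ / 2) * x ^ (θ / 2) := by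
    rw [← Real.rpow_add hx]; congr 1; ring
  rw [div_le_iff₀ ha] at h2
  have h4 : 2 * x ^ (θ / 2) ≤ a * x ^ θ := by
    rw [h3]
    nlinarith [Real.rpow_pos_of_pos hx (θ / 2)]
  calc A * x ^ d * Real.exp (-(a * x ^ θ))
      ≤ Real.exp (x ^ (θ / 2)) * Real.exp (-(2 * x ^ (θ / 2))) :=
        mul_le_mul ((le_abs_self _).trans h1) (Real.exp_le_exp.2 (by linarith))
          (Real.exp_pos _).le (Real.exp_pos _).le
    _ = Real.exp (-x ^ (θ / 2)) := by rw [← Real.exp_add]; congr 1; ring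

lemma two_pow_div_le {κ x : ℝ} (hκ : 3 ≤ κ) {w : ℕ} (hw : 2 ≤ w) (hx : x ≤ w + 1) :
    2 ^ w / κ ^ (w - 2) ≤ κ ^ 2 * (3 / 2) * Real.exp (-(Real.log (3 / 2) * x)) := by
  have hκ0 : 0 < κ := by linarith
  have h1 : (2 : ℝ) ^ w / κ ^ (w - 2) = κ ^ 2 * (2 / κ) ^ w := by
    rw [div_pow, div_eq_iff (by positivity)]
    have : κ ^ w = κ ^ 2 * κ ^ (w - 2) := by rw [← pow_add]; congr 1; omega
    rw [this]
    field_simp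
  have h2 : (2 / κ) ^ w ≤ (2 / 3 : ℝ) ^ w :=
    pow_le_pow_left₀ (by positivity) (div_le_div_of_nonneg_left (by norm_num) (by norm_num) hκ) w
  have h3 : (2 / 3 : ℝ) ^ w = 3 / 2 * Real.exp (-(Real.log (3 / 2) * (w + 1))) := by
    have : Real.exp (-(Real.log (3 / 2) * (w + 1))) = (2 / 3 : ℝ) ^ (w + 1) := by
      rw [← Real.exp_log (show (0 : ℝ) < (2 / 3) ^ (w + 1) by positivity), Real.log_pow,
        show (2 / 3 : ℝ) = (3 / 2)⁻¹ by norm_num, Real.log_inv]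
      push_cast
      congr 1
      ring
    rw [this, pow_succ]
    ring
  have h4 : Real.exp (-(Real.log (3 / 2) * (w + 1))) ≤ Real.exp (-(Real.log (3 / 2) * x)) := by
    have := Real.log_pos (show (1 : ℝ) < 3 / 2 by norm_num)
    exact Real.exp_le_exp.2 (neg_le_neg (mul_le_mul_of_nonneg_left hx this.le))
  rw [h1, mul_assoc]
  refine mul_le_mul_of_nonneg_left (h2.trans ?_) (by positivity)
  rw [h3]
  exact mul_le_mul_of_nonneg_left h4 (by norm_num)

lemma rpow_le_pow_floor {κ C x : ℝ} (hκ : 1 < κ) (hx : 0 < x) :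
    x ^ (C * Real.log κ) ≤ κ * κ ^ ⌊C * Real.log x⌋₊ := by
  have h1 : x ^ (C * Real.log κ) = κ ^ (C * Real.log x) := by
    rw [Real.rpow_def_of_pos hx, Real.rpow_def_of_pos (by linarith)]
    congr 1
    ring
  rw [h1, ← pow_succ', ← Real.rpow_natCast]
  refine Real.rpow_le_rpow_of_exponent_le hκ.le ?_
  push_cast
  exact (Nat.lt_floor_add_one _).le

/-- The numerator is at most `5 * x ^ η`, and the denominator is at least `x ^ (2 * η)` up to the
constant `κ ^ 3`; the spare factor `x ^ η` beats the constants. -/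
lemma lip_ratio_le {κ C η x : ℝ} (hκ : 1 < κ) (hη : 0 < η) (hηC : 2 * η ≤ C * Real.log κ)
    (hx : 1 ≤ x) (hl : 2 ≤ ⌊C * Real.log x⌋₊) (hbig : 5 * κ ^ 3 * Real.exp 1 ≤ x ^ η) :
    (4 * (⌊x ^ η⌋₊ : ℝ) + 1) / κ ^ (⌊C * Real.log x⌋₊ - 2) ≤ Real.exp (-1) := by
  have hκ0 : 0 < κ := by linarith
  have hx0 : 0 < x := by linarith
  have h1 := rpow_le_pow_floor (C := C) hκ hx0
  set l := ⌊C * Real.log x⌋₊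
  have h2 : κ * κ ^ l = κ ^ 3 * κ ^ (l - 2) := by
    rw [← pow_succ', ← pow_add]; congr 1; omega
  have h3 : x ^ η * x ^ η ≤ x ^ (C * Real.log κ) := by
    rw [← Real.rpow_add hx0]
    exact Real.rpow_le_rpow_of_exponent_le hx (by linarith)
  have h4 : 1 ≤ x ^ η := Real.one_le_rpow hx hη.le
  have h5 : (⌊x ^ η⌋₊ : ℝ) ≤ x ^ η := Nat.floor_le (by linarith)
  rw [div_le_iff₀ (by positivity), Real.exp_neg, ← div_eq_inv_mul,
    le_div_iff₀ (Real.exp_pos 1)]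
  have h6 : 5 * κ ^ 3 * Real.exp 1 * x ^ η ≤ κ ^ 3 * κ ^ (l - 2) := by
    rw [← h2]
    exact ((mul_le_mul_of_nonneg_right hbig (by linarith)).trans h3).trans h1
  have h7 : 5 * x ^ η * Real.exp 1 ≤ κ ^ (l - 2) := by
    have hκ3 : 0 < κ ^ 3 := by positivity
    refine le_of_mul_le_mul_left ?_ hκ3
    linarith
  refine le_trans (mul_le_mul_of_nonneg_right ?_ (Real.exp_pos 1).le) h7
  linarith

lemma eventually_error_le {κ C δ η c : ℝ} (N : ℕ) (hκ : 3 ≤ κ) (hC : 0 < C) (hδ : 0 < δ)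
    (hη : 0 < η) (hηC : 2 * η ≤ C * Real.log κ) (hc : c = min η (δ / 2) / 2) :
    ∀ᶠ x : ℝ in atTop,
      2 * x * (x + 1) ^ 3 * (2 * (N * x) * 2 ^ ⌊x ^ η⌋₊ / κ ^ (⌊x ^ η⌋₊ - 2)) +
        2 * x * (x + 1) ^ 2 * ((4 * (⌊x ^ η⌋₊ : ℝ) + 1) / κ ^ (⌊C * Real.log x⌋₊ - 2)) ^
          ⌊x ^ (δ / 2)⌋₊ ≤ Real.exp (-x ^ c) := by
  have hθ : 0 < min η (δ / 2) := lt_min hη (by linarith)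
  have hlog : 0 < Real.log (3 / 2) := Real.log_pos (by norm_num)
  have hlog1 : Real.log (3 / 2) ≤ 1 := by
    have := Real.log_le_sub_one_of_pos (show (0 : ℝ) < 3 / 2 by norm_num)
    linarith
  have hl : ∀ᶠ x : ℝ in atTop, 2 ≤ ⌊C * Real.log x⌋₊ := by
    have := (Real.tendsto_log_atTop.const_mul_atTop hC).eventually_ge_atTop 2
    filter_upwards [this] with x hx
    exact Nat.le_floor (by exact_mod_cast hx)
  filter_upwards [eventually_pow_mul_exp_le hθ hlog
      (48 * N * κ ^ 2 + 8 * Real.exp 1) 5, hl,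
    (tendsto_rpow_atTop hη).eventually_ge_atTop (5 * κ ^ 3 * Real.exp 1),
    (tendsto_rpow_atTop hη).eventually_ge_atTop 2, eventually_ge_atTop 1] with x h1 h2 h3 h4 hx
  rw [hc]
  refine le_trans ?_ h1
  have hE : ∀ {e : ℝ}, min η (δ / 2) ≤ e →
      x ^ min η (δ / 2) ≤ x ^ e := fun he => Real.rpow_le_rpow_of_exponent_le hx he
  set E := Real.exp (-(Real.log (3 / 2) * x ^ min η (δ / 2))) with hEdef
  have hA := two_pow_div_le hκ (w := ⌊x ^ η⌋₊) (Nat.le_floor (by exact_mod_cast h4))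
    (x := x ^ min η (δ / 2)) ((hE (min_le_left _ _)).trans (Nat.lt_floor_add_one _).le)
  rw [← hEdef] at hA
  have hB : ((4 * (⌊x ^ η⌋₊ : ℝ) + 1) / κ ^ (⌊C * Real.log x⌋₊ - 2)) ^ ⌊x ^ (δ / 2)⌋₊ ≤
      Real.exp 1 * E := by
    have hr := lip_ratio_le (by linarith) hη hηC hx h2 h3
    have hr0 : 0 ≤ (4 * (⌊x ^ η⌋₊ : ℝ) + 1) / κ ^ (⌊C * Real.log x⌋₊ - 2) := by positivity
    refine (pow_le_pow_left₀ hr0 hr _).trans ?_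
    rw [← Real.exp_nat_mul, hEdef, ← Real.exp_add]
    refine Real.exp_le_exp.2 ?_
    have h5 := hE (min_le_right η (δ / 2))
    have h6 := Nat.lt_floor_add_one (x ^ (δ / 2))
    have h7 : 0 ≤ x ^ min η (δ / 2) := by positivity
    nlinarith
  have hE0 : 0 < E := Real.exp_pos _
  have hx3 : (x + 1) ^ 3 ≤ 8 * x ^ 3 := by
    calc (x + 1) ^ 3 ≤ (2 * x) ^ 3 := pow_le_pow_left₀ (by linarith) (by linarith) 3
      _ = 8 * x ^ 3 := by ring
  have hx2 : (x + 1) ^ 2 ≤ 4 * x ^ 2 := by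
    calc (x + 1) ^ 2 ≤ (2 * x) ^ 2 := pow_le_pow_left₀ (by linarith) (by linarith) 2
      _ = 4 * x ^ 2 := by ring
  have hA' : 2 * x * (x + 1) ^ 3 * (2 * (N * x) * 2 ^ ⌊x ^ η⌋₊ / κ ^ (⌊x ^ η⌋₊ - 2)) ≤
      48 * N * κ ^ 2 * x ^ 5 * E := by
    calc _ = 2 * x * (x + 1) ^ 3 * (2 * (N * x)) * (2 ^ ⌊x ^ η⌋₊ / κ ^ (⌊x ^ η⌋₊ - 2)) := by
          ring
      _ ≤ 2 * x * (8 * x ^ 3) * (2 * (N * x)) * (κ ^ 2 * (3 / 2) * E) := by gcongr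
      _ = _ := by ring
  have hB' : 2 * x * (x + 1) ^ 2 * ((4 * (⌊x ^ η⌋₊ : ℝ) + 1) /
      κ ^ (⌊C * Real.log x⌋₊ - 2)) ^ ⌊x ^ (δ / 2)⌋₊ ≤ 8 * Real.exp 1 * x ^ 5 * E := by
    calc _ ≤ 2 * x * (4 * x ^ 2) * (Real.exp 1 * E) := by gcongr
      _ = 8 * Real.exp 1 * E * x ^ 3 := by ring
      _ ≤ 8 * Real.exp 1 * E * x ^ 5 :=
        mul_le_mul_of_nonneg_left (pow_le_pow_right₀ hx (by norm_num)) (by positivity)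
      _ = _ := by ring
  calc _ ≤ 48 * N * κ ^ 2 * x ^ 5 * E + 8 * Real.exp 1 * x ^ 5 * E := add_le_add hA' hB'
    _ = _ := by ring

/-- The sizes chosen in the proof fit into the word. -/
lemma eventually_sizes {C δ η β : ℝ} (hC : 0 < C) (hδ : 0 < δ) (hδ' : δ < 1 / 2) (hη : 0 < η)
    (hη' : η ≤ 1 / 4) (hβ : 0 < β) :
    ∀ᶠ x : ℝ in atTop, 2 ≤ ⌊C * Real.log x⌋₊ ∧ ⌊C * Real.log x⌋₊ ≤ ⌊x ^ η⌋₊ ∧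
      16 * (⌊x ^ η⌋₊ : ℝ) ≤ x ^ (1 - δ) ∧
      (⌊x ^ (δ / 2)⌋₊ + 4) * ⌈x ^ (1 - δ)⌉₊ ≤ ⌊min β 1 / 4 * x⌋₊ ∧
      0 < ⌊min β 1 / 4 * x⌋₊ := by
  have hb : 0 < min β 1 / 4 := by have := lt_min hβ one_pos; positivity
  have hl := (Real.tendsto_log_atTop.const_mul_atTop hC).eventually_ge_atTop 2
  filter_upwards [hl, eventually_log_le hη C,
    eventually_mul_rpow_le (show η < 1 - δ by linarith) one_pos 16,
    eventually_mul_rpow_le (show 1 - δ / 2 < 1 by linarith) hb 10,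
    eventually_ge_atTop 1, eventually_ge_atTop (1 / (min β 1 / 4))] with x h1 h2 h3 h4 hx h5
  have hx0 : 0 < x := by linarith
  rw [Real.rpow_one] at h4
  refine ⟨Nat.le_floor (by exact_mod_cast h1), Nat.floor_mono h2, ?_, ?_, ?_⟩
  · have : (⌊x ^ η⌋₊ : ℝ) ≤ x ^ η := Nat.floor_le (by positivity)
    linarith
  · refine Nat.le_floor ?_
    push_cast
    have e1 : (⌊x ^ (δ / 2)⌋₊ : ℝ) ≤ x ^ (δ / 2) := Nat.floor_le (by positivity)
    have e2 : (⌈x ^ (1 - δ)⌉₊ : ℝ) ≤ x ^ (1 - δ) + 1 := (Nat.ceil_lt_add_one (by positivity)).le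
    have e3 : 1 ≤ x ^ (δ / 2) := Real.one_le_rpow hx (by linarith)
    have e4 : 1 ≤ x ^ (1 - δ) := Real.one_le_rpow hx (by linarith)
    have e5 : x ^ (1 - δ / 2) = x ^ (δ / 2) * x ^ (1 - δ) := by
      rw [← Real.rpow_add hx0]; congr 1; ring
    calc ((⌊x ^ (δ / 2)⌋₊ : ℝ) + 4) * ⌈x ^ (1 - δ)⌉₊
        ≤ (5 * x ^ (δ / 2)) * (2 * x ^ (1 - δ)) :=
          mul_le_mul (by linarith) (by linarith) (Nat.cast_nonneg _) (by positivity)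
      _ = 10 * x ^ (1 - δ / 2) := by rw [e5]; ring
      _ ≤ _ := h4
  · refine Nat.floor_pos.2 ?_
    rw [div_le_iff₀ hb] at h5
    linarith

lemma prob_nonneg (k n : ℕ) (E : Set (ZMod n → Letter k)) : 0 ≤ prob k n E := by
  unfold prob; positivity

end Beads

/-! ### Choice of the parameters -/

theorem lemma5p2p3 (k : ℕ) (hk : 2 ≤ k) (L N : ℕ) (C δ : ℝ) (hC : 0 < C) (hδ : 0 < δ)
    (hCδ : C < (1 - 2 * δ) / Real.log (2 * (k : ℝ) - 1)) (β : ℝ) (hβ : 0 < β) :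
    ∃ c : ℝ, 0 < c ∧ ∀ ε : ℕ → ℝ, Filter.Tendsto ε Filter.atTop (nhds 0) →
      ∃ K : ℝ, ∀ n : ℕ, 1 ≤ n → ∀ gap : ℕ → ℕ,
        (∀ i, |(gap i : ℝ) - (n : ℝ) ^ (1 - δ) / 2| ≤ ε n * (n : ℝ) ^ (1 - δ)) →
        ∀ R : Beads.BeadRule k N n,
          1 - K * Real.exp (-(n : ℝ) ^ c) ≤
            Beads.prob k n {r | ∀ (o : ZMod n) (M : ℕ) (p : ℕ → ℕ),
              Beads.IsBeadDecomposition C δ (ε n) gap r o M p →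
              ∀ Y : Beads.Fatgraph (Beads.Side N n),
                Beads.IsBeadedSpine L (Beads.lipLength C n) R r o M p Y →
                ∀ (m : ℕ) (γ : ℕ → Beads.Side N n), β * n ≤ m →
                  Y.IsPath m γ → Beads.Appears r m γ → Y.InBoundary m γ} := by
  have hκ : (3 : ℝ) ≤ 2 * (k : ℝ) - 1 := by
    have : (2 : ℝ) ≤ k := by exact_mod_cast hk
    linarith
  have hlogκ : 0 < Real.log (2 * (k : ℝ) - 1) := Real.log_pos (by linarith)
  have hδ' : δ < 1 / 2 := by
    rw [lt_div_iff₀ hlogκ] at hCδ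
    have := mul_pos hC hlogκ
    linarith
  -- The first bound makes the lip words outnumber the shifts; the second keeps windows shorter than
  -- beads, as `1 / 4 < 1 - δ`.
  set η : ℝ := min (C * Real.log (2 * (k : ℝ) - 1) / 2) (1 / 4) with hηdef
  have hη : 0 < η := lt_min (by positivity) (by norm_num)
  have hηC : 2 * η ≤ C * Real.log (2 * (k : ℝ) - 1) := by
    have := min_le_left (C * Real.log (2 * (k : ℝ) - 1) / 2) (1 / 4)
    linarith
  have hc : 0 < min η (δ / 2) / 2 := half_pos (lt_min hη (by linarith))
  refine ⟨min η (δ / 2) / 2, hc, fun ε hε => ?_⟩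
  have hev : ∀ᶠ n : ℕ in Filter.atTop, |ε n| ≤ 1 / 4 := by
    have := (tendsto_zero_iff_abs_tendsto_zero ε).1 hε
    exact (this.eventually (gt_mem_nhds (show (0 : ℝ) < 1 / 4 by norm_num))).mono
      fun n hn => le_of_lt hn
  obtain ⟨n₀, hn₀⟩ := Filter.eventually_atTop.1 ((hev.and
    (tendsto_natCast_atTop_atTop.eventually
      (Beads.eventually_error_le N hκ hC hδ hη hηC rfl))).and
    (tendsto_natCast_atTop_atTop.eventually
      (Beads.eventually_sizes hC hδ hδ' hη (min_le_right _ _) hβ)))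
  -- With this constant the bound is trivial for `n < n₀`.
  refine ⟨Real.exp ((n₀ : ℝ) ^ (min η (δ / 2) / 2)), fun n hn gap _ R => ?_⟩
  rcases Nat.lt_or_ge n n₀ with hlt | hge
  · refine le_trans ?_ (Beads.prob_nonneg k n _)
    rw [sub_nonpos, ← Real.exp_add]
    refine Real.one_le_exp ?_
    have : (n : ℝ) ^ (min η (δ / 2) / 2) ≤ (n₀ : ℝ) ^ (min η (δ / 2) / 2) :=
      Real.rpow_le_rpow (Nat.cast_nonneg _) (by exact_mod_cast hlt.le) hc.le
    linarith
  · have : NeZero n := ⟨by omega⟩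
    obtain ⟨⟨h1, h2⟩, h3, h4, h5, h6, h7⟩ := hn₀ n hge
    have hb : (⌊min β 1 / 4 * (n : ℝ)⌋₊ : ℝ) ≤ min β 1 / 4 * n :=
      Nat.floor_le (by have := lt_min hβ one_pos; positivity)
    have hn0 : (0 : ℝ) ≤ n := Nat.cast_nonneg _
    have hb1 : min β 1 * (n : ℝ) ≤ β * n := mul_le_mul_of_nonneg_right (min_le_left _ _) hn0
    have hb2 : min β 1 * (n : ℝ) ≤ 1 * n := mul_le_mul_of_nonneg_right (min_le_right _ _) hn0
    have hb0 : (0 : ℝ) ≤ ⌊min β 1 / 4 * (n : ℝ)⌋₊ := Nat.cast_nonneg _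
    refine le_trans ?_ (Beads.one_sub_le_prob hk
      (F := Beads.exceptional C δ (ε n) gap L R ⌊(n : ℝ) ^ η⌋₊ ⌊(n : ℝ) ^ (δ / 2)⌋₊) ?_
      (Beads.ncard_exceptional_le C δ (ε n) gap L R hk _ h3 h4))
    · refine sub_le_sub_left (h2.trans ?_) 1
      exact le_mul_of_one_le_left (Real.exp_pos _).le (Real.one_le_exp (by positivity))
    · intro r hr hE
      by_contra hF
      refine hE fun o M p hd Y hY m γ hm hγ ha => ?_
      refine Beads.inBoundary_of_notMem_exceptional h3 h4 h1 h5 (Nat.le_ceil _) h6 h7 ?_ ?_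
        hr hF hd hY hm hγ ha
      · linarith
      · have : (2 * (⌊min β 1 / 4 * (n : ℝ)⌋₊ : ℝ)) ≤ n := by linarith
        exact_mod_cast this
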